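/- Setting. Let $\mathcal S$ be a state space, $\mathcal A$ a finite action set, $\mathsf P(ds'\mid s,a)$ a transition kernel, $r$ a measurable reward with $0\le r\le r_{\max}$, $\gamma\in(0,1)$ a discount factor, $\pi_b$ a behavior policy, and $\phi_{s,a}\in\mathbb R^N$ measurable features with $\|\phi_{s,a}\|_2\le 1$; write $Q_\theta(s,a)=\phi_{s,a}^\top\theta$. Let $\mu$ be an invariant probability measure of the chain $(s_t,a_t)$ generated by $\pi_b$ and $\mathsf P$. Assume that (i) $C=\mathbb E_\mu[\phi\phi^\top]$ is non-singular; (ii) there are $m>0$ and $\rho\in(0,1)$ such that $\sup_{s}d_{TV}(\mathbb P(s_t\in\cdot\mid s_0=s),\mu_{\mathcal S})\le m\rho^t$ for all $t>0$, where $\mu_{\mathcal S}$ is the state marginal of $\mu$; (iii) for each $\theta\in\mathbb R^N$, $\pi_\theta$ is a stationary policy, $\theta\mapsto\pi_\theta(a\mid s)$ is differentiable, $\|\nabla\pi_\theta(a\mid s)\|\le k_1$, and $\|\nabla\pi_{\theta_1}(a\mid s)-\nabla\pi_{\theta_2}(a\mid s)\|\le k_2\|\theta_1-\theta_2\|$ for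 all $s,a,\theta,\theta_1,\theta_2$. Let $\mathbf T^{\pi}Q(s,a)=\mathbb E[r(s,a,S')+\gamma Q(S',A')]$ with $S'\sim\mathsf P(\cdot\mid s,a)$, $A'\sim\pi(\cdot\mid S')$, let $\mathbf\Pi$ be the $L^2(\mu)$-projection onto $\{Q_\theta\}$, and let $J(\theta)=\|\mathbf\Pi\mathbf T^{\pi_\theta}Q_\theta-Q_\theta\|_{L^2(\mu)}^2$ (the MSPBE). Put $\bar V_s(\theta)=\sum_a\pi_\theta(a\mid s)\theta^\top\phi_{s,a}$ and $\delta_{s,a,s'}(\theta)=r(s,a,s')+\gamma\bar V_{s'}(\theta)-\theta^\top\phi_{s,a}$. Algorithm. Along a single trajectory $(s_t,a_t)$ of the chain generated by $\pi_b$ and $\mathsf P$, with $\phi_t=\phi_{s_t,a_t}$ and $\delta_{t+1}=\delta_{s_t,a_t,s_{t+1}}(\theta_t)$, Greedy-GQ iterates from deterministic $\theta_0,\omega_0$ $$\theta_{t+1}=\theta_t+\alpha_t\bigl(\delta_{t+1}\phi_t-\gamma(\omega_t^\top\phi_t)\nabla\bar V_{s_{t+1}}(\theta_t)\bigr),\qquad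 \omega_{t+1}=\omega_t+\beta_t(\delta_{t+1}-\phi_t^\top\omega_t)\phi_t .$$ Theorem 1. Let $\tfrac12<a\le1$, $0<b\le a$ and $R$ be fixed. Then $J$ is differentiable, and there is a constant $K$, depending only on the above data and on $a,b,R$, such that the following holds for every integer $T>0$. Run Greedy-GQ with $\alpha_t=T^{-a}$, $\beta_t=T^{-b}$, and suppose that almost surely $\|\theta_t\|\le R$ and $\|\omega_t\|\le R$ for all $t\le T$. Let $M$ be independent of the trajectory, with $\mathbb P(M=k)$ proportional to $\alpha_k$ on $\{1,\dots,T\}$ (or on $\{0,\dots,T\}$). Then $\|\nabla J(\theta_M)\|^2$ is integrable and $$\mathbb E\|\nabla J(\theta_M)\|^2\le K\left(\frac1{T^{1-a}}+\frac{\log T}{T^{\min\{b,a-b\}}}\right).$$ -/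

import Mathlib

open MeasureTheory ProbabilityTheory

noncomputable section

namespace GreedyGQ

/-- The data of the off-policy control problem with linear function approximation: the transition
kernel `P(ds' | s, a)`, the behavior policy `π_b(a | s)`, the reward `r(s, a, s')`, the discount
factor `γ`, the feature vectors `φ_{s,a} ∈ ℝ^N`, and the family of target policies
`target θ s a = π_θ(a | s)`. -/
structure Model (S A : Type*) [MeasurableSpace S] [MeasurableSpace A] (N : ℕ) where
  trans : Kernel (S × A) S
  behavior : Kernel S A
  reward : S → A → S → ℝ
  γ : ℝ
  feature : S → A → EuclideanSpace ℝ (Fin N)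
  target : EuclideanSpace ℝ (Fin N) → S → A → ℝ

/-- Total variation distance of two probability measures, `sup_U |μ(U) - ν(U)|`. -/
def tvDist {X : Type*} [MeasurableSpace X] (μ ν : Measure X) : ℝ :=
  ⨆ U : {U : Set X // MeasurableSet U}, |μ.real U - ν.real U|

variable {S A : Type*} [MeasurableSpace S] [MeasurableSpace A] {N : ℕ}

namespace Model

variable (m : Model S A N)

/-- One step of the behavior chain: from the state `s`, the law of the pair `(a, s')` with
`a ∼ π_b(· | s)` and `s' ∼ P(· | s, a)`. -/
def stepKernel : Kernel S (A × S) := m.behavior ⊗ₖ m.trans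

/-- The transition kernel of the state process under the behavior policy. -/
def stateKernel : Kernel S S := m.stepKernel.snd

/-- The transition kernel of the state-action process under the behavior policy:
`s' ∼ P(· | s, a)`, then `a' ∼ π_b(· | s')`. -/
def pairKernel : Kernel (S × A) (S × A) :=
  m.trans ⊗ₖ (m.behavior.comap Prod.snd measurable_snd)

/-- The linear action-value function `Q_θ(s, a) = φ_{s,a}ᵀ θ`. -/
def Q (θ : EuclideanSpace ℝ (Fin N)) (s : S) (a : A) : ℝ := inner ℝ (m.feature s a) θ

/-- The matrix `C = E_μ[φ φᵀ]`. -/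
def featureCov (μ : Measure (S × A)) : Matrix (Fin N) (Fin N) ℝ :=
  Matrix.of fun i j => ∫ x, m.feature x.1 x.2 i * m.feature x.1 x.2 j ∂μ

/-- The Bellman operator of a policy `p`:
`(T^p f)(s, a) = E[r(s, a, S') + γ f(S', A')]`, `S' ∼ P(· | s, a)`, `A' ∼ p(· | S')`. -/
def bellman [Fintype A] (p : S → A → ℝ) (f : S → A → ℝ) (s : S) (a : A) : ℝ :=
  ∫ s', (m.reward s a s' + m.γ * ∑ a', p s' a' * f s' a') ∂(m.trans (s, a))

/-- `u` is the parameter of a best approximation of `f` in the class `{Q_v}` for the `L²(μ)`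
norm. -/
def IsBestApprox (μ : Measure (S × A)) (f : S → A → ℝ) (u : EuclideanSpace ℝ (Fin N)) : Prop :=
  ∀ v, ∫ x, (m.Q u x.1 x.2 - f x.1 x.2) ^ 2 ∂μ ≤ ∫ x, (m.Q v x.1 x.2 - f x.1 x.2) ^ 2 ∂μ

/-- The projection `Π f` of `f` onto the linear class `{Q_v}` for the `L²(μ)` norm. -/
def proj (μ : Measure (S × A)) (f : S → A → ℝ) : S → A → ℝ :=
  m.Q (Classical.epsilon (m.IsBestApprox μ f))

/-- The mean squared projected Bellman error `J(θ) = ‖Π T^{π_θ} Q_θ - Q_θ‖²_μ`. -/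
def J [Fintype A] (μ : Measure (S × A)) (θ : EuclideanSpace ℝ (Fin N)) : ℝ :=
  ∫ x, (m.proj μ (m.bellman (m.target θ) (m.Q θ)) x.1 x.2 - m.Q θ x.1 x.2) ^ 2 ∂μ

/-- `V̄_s(θ) = ∑_a π_θ(a | s) θᵀ φ_{s,a}`. -/
def Vbar [Fintype A] (s : S) (θ : EuclideanSpace ℝ (Fin N)) : ℝ :=
  ∑ a, m.target θ s a * m.Q θ s a

/-- The temporal difference error `δ_{s,a,s'}(θ) = r(s,a,s') + γ V̄_{s'}(θ) - θᵀ φ_{s,a}`. -/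
def δ [Fintype A] (s : S) (a : A) (s' : S) (θ : EuclideanSpace ℝ (Fin N)) : ℝ :=
  m.reward s a s' + m.γ * m.Vbar s' θ - m.Q θ s a

/-- `φ̂_{s'}(θ)`, the gradient of `V̄_{s'}` at `θ`. -/
def phiHat [Fintype A] (s' : S) (θ : EuclideanSpace ℝ (Fin N)) : EuclideanSpace ℝ (Fin N) :=
  gradient (m.Vbar s') θ

/-- The Greedy-GQ iterates `(θ_t, ω_t)` with stepsizes `α_t`, `β_t`, started at `(θ₀, ω₀)` and
driven by the state sequence `s` and the action sequence `act`. -/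
def iter [Fintype A] (α β : ℕ → ℝ) (θ₀ ω₀ : EuclideanSpace ℝ (Fin N)) (s : ℕ → S)
    (act : ℕ → A) : ℕ → EuclideanSpace ℝ (Fin N) × EuclideanSpace ℝ (Fin N)
  | 0 => (θ₀, ω₀)
  | t + 1 =>
    let θ := (iter α β θ₀ ω₀ s act t).1
    let ω := (iter α β θ₀ ω₀ s act t).2
    let φ := m.feature (s t) (act t)
    let d := m.δ (s t) (act t) (s (t + 1)) θ
    (θ + α t • (d • φ - (m.γ * inner ℝ ω φ) • m.phiHat (s (t + 1)) θ),
      ω + β t • ((d - inner ℝ φ ω) • φ))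

/-- The process `(s_t, a_t)` is a single trajectory of the decision process under the behavior
policy (with an arbitrary initial state): given the past `(s_0, a_0, …, s_{t-1}, a_{t-1}, s_t)`,
the pair `(a_t, s_{t+1})` has the law `π_b(da | s_t) P(ds' | s_t, a)`. -/
structure IsTrajectory {Ω : Type*} [MeasurableSpace Ω] (Pr : Measure Ω) (s : ℕ → Ω → S)
    (act : ℕ → Ω → A) : Prop where
  measurable_state : ∀ t, Measurable (s t)
  measurable_action : ∀ t, Measurable (act t)
  step_law : ∀ t : ℕ,
    Pr.map (fun w => (((fun i : Fin t => (s i w, act i w)), s t w), (act t w, s (t + 1) w))) =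
      (Pr.map (fun w => ((fun i : Fin t => (s i w, act i w)), s t w))) ⊗ₘ
        (m.stepKernel.comap Prod.snd measurable_snd)

/-- The standing assumptions. `μ` is the invariant distribution of the state-action chain under
the behavior policy. -/
structure Assumptions [Fintype A] (μ : Measure (S × A)) (rmax C₀ ρ k₁ k₂ : ℝ) : Prop where
  trans_markov : IsMarkovKernel m.trans
  behavior_markov : IsMarkovKernel m.behavior
  γ_pos : 0 < m.γ
  γ_lt_one : m.γ < 1
  reward_measurable : Measurable fun x : S × A × S => m.reward x.1 x.2.1 x.2.2
  reward_nonneg : ∀ s a s', 0 ≤ m.reward s a s'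
  reward_le : ∀ s a s', m.reward s a s' ≤ rmax
  feature_measurable : Measurable fun x : S × A => m.feature x.1 x.2
  /- bounded features -/
  feature_le : ∀ s a, ‖m.feature s a‖ ≤ 1
  /- each `π_θ` is a stationary policy -/
  target_measurable : ∀ θ a, Measurable fun s => m.target θ s a
  target_nonneg : ∀ θ s a, 0 ≤ m.target θ s a
  target_sum : ∀ θ s, ∑ a, m.target θ s a = 1
  /- the policy is `k₁`-Lipschitz and `k₂`-smooth in `θ` -/
  target_differentiable : ∀ s a, Differentiable ℝ fun θ => m.target θ s a
  target_grad_le : ∀ s a θ, ‖gradient (fun θ' => m.target θ' s a) θ‖ ≤ k₁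
  target_grad_lipschitz : ∀ s a θ₁ θ₂,
    ‖gradient (fun θ' => m.target θ' s a) θ₁ - gradient (fun θ' => m.target θ' s a) θ₂‖
      ≤ k₂ * ‖θ₁ - θ₂‖
  /- `μ` is an invariant probability measure of the chain `(s_t, a_t)` -/
  probability : IsProbabilityMeasure μ
  invariant : Kernel.Invariant m.pairKernel μ
  /- `C = E_μ[φ φᵀ]` is non-singular -/
  nonsingular : IsUnit (m.featureCov μ).det
  /- geometric uniform ergodicity of the state process -/
  C₀_pos : 0 < C₀
  ρ_pos : 0 < ρ
  ρ_lt_one : ρ < 1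
  ergodic : ∀ (s : S) (t : ℕ), 0 < t →
    tvDist ((m.stateKernel ^ t) s) (μ.map Prod.fst) ≤ C₀ * ρ ^ t

end Model

end GreedyGQ

end

/-! Write b(θ) = E[δ(θ)φ] under the stationary law of a transition and w(θ) = C⁻¹b(θ). The Bellman
image of Q_θ projects to Q_{θ+w(θ)}, so the objective is the quadratic form ⟨b, C⁻¹b⟩ (`J_eq`). Its
gradient is -2 times the stationary mean of the main update direction at (θ, w(θ)): the terms of the
first variation that do not belong to this direction form the mean of the auxiliary direction, which
vanishes exactly at ω = w(θ) (`inner_meanMainDir`). Since the policies are smooth in θ, the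
first-order expansion of J has a quadratic remainder on balls (`J_taylor`).

The algorithm is thus a two-time-scale stochastic approximation with two Lyapunov functions. Along
the mean dynamics, J decreases at a rate proportional to ‖∇J‖², up to a multiple of the squared
tracking error ‖ω - w(θ)‖² (`integral_mainDrift_le`). The tracking error itself contracts because C
is coercive (`integral_auxDrift_le`), but it is disturbed by order α at each step because its target
w(θ) moves (`trackErr_update_le`). The coupling goes one way: the summed tracking error is bounded
first and then inserted into the descent of J.

The samples are Markovian, so actual drifts must be exchanged for stationary ones. A truncated
Poisson equation (`poisson_equation`) writes the deviation as a term that telescopes along the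
trajectory, plus the effect of the slow motion of the iterates and a geometrically small rest. The
total cost over T steps is of order 1 + Tβ (`sum_integral_sub_le`), with no mixing-time logarithm.

Together this bounds ∑ E‖∇J(θ_t)‖² by a multiple of 1/α + T(β + α/β) (`exists_sum_grad_le`).
Division by T gives T^{a-1} + T^{-b} + T^{-(a-b)}; the logarithm in the stated rate is slack
(`rate_le`). -/

/-! ### Calculus of uniformly bounded and Lipschitz families -/

/-- On the set `D` of parameters, the family `f` is bounded and Lipschitz, uniformly in the second
argument. -/
def BddLip {X Z F : Type*} [NormedAddCommGroup X] [NormedAddCommGroup F] (D : Set X)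
    (f : X → Z → F) : Prop :=
  ∃ L : ℝ, 0 ≤ L ∧ (∀ x ∈ D, ∀ z, ‖f x z‖ ≤ L) ∧
    ∀ x ∈ D, ∀ y ∈ D, ∀ z, ‖f x z - f y z‖ ≤ L * ‖x - y‖

namespace BddLip

variable {X Y Z Z' F F' : Type*} [NormedAddCommGroup X] [NormedAddCommGroup Y]
  [NormedAddCommGroup F] [NormedAddCommGroup F'] {D : Set X}

theorem of_bounds {f : X → Z → F} (B L : ℝ) (hB : ∀ x ∈ D, ∀ z, ‖f x z‖ ≤ B)
    (hL : ∀ x ∈ D, ∀ y ∈ D, ∀ z, ‖f x z - f y z‖ ≤ L * ‖x - y‖) : BddLip D f := by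
  refine ⟨max 0 (max B L), le_max_left _ _, fun x hx z => (hB x hx z).trans (by simp),
    fun x hx y hy z => (hL x hx y hy z).trans ?_⟩
  gcongr
  simp

theorem const {c : Z → F} (B : ℝ) (hB : ∀ z, ‖c z‖ ≤ B) : BddLip D fun _ z => c z :=
  of_bounds B 0 (fun _ _ z => hB z) (by simp)

theorem mono {D' : Set X} {f : X → Z → F} (hf : BddLip D f) (h : D' ⊆ D) : BddLip D' f := by
  obtain ⟨L, h0, h1, h2⟩ := hf
  exact ⟨L, h0, fun x hx => h1 x (h hx), fun x hx y hy => h2 x (h hx) y (h hy)⟩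

theorem add {f g : X → Z → F} (hf : BddLip D f) (hg : BddLip D g) :
    BddLip D fun x z => f x z + g x z := by
  obtain ⟨L, h0, h1, h2⟩ := hf
  obtain ⟨L', h0', h1', h2'⟩ := hg
  refine ⟨L + L', by positivity, fun x hx z => (norm_add_le _ _).trans ?_,
    fun x hx y hy z => ?_⟩
  · exact add_le_add (h1 x hx z) (h1' x hx z)
  · rw [add_sub_add_comm, add_mul]
    exact (norm_add_le _ _).trans (add_le_add (h2 x hx y hy z) (h2' x hx y hy z))

theorem neg {f : X → Z → F} (hf : BddLip D f) : BddLip D fun x z => -f x z := by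
  obtain ⟨L, h0, h1, h2⟩ := hf
  refine ⟨L, h0, fun x hx z => by simpa using h1 x hx z, fun x hx y hy z => ?_⟩
  rw [← neg_sub', norm_neg]
  exact h2 x hx y hy z

theorem sub {f g : X → Z → F} (hf : BddLip D f) (hg : BddLip D g) :
    BddLip D fun x z => f x z - g x z := by
  simpa only [sub_eq_add_neg] using hf.add hg.neg

theorem sum {ι : Type*} (s : Finset ι) {f : ι → X → Z → F} (hf : ∀ i, BddLip D (f i)) :
    BddLip D fun x z => ∑ i ∈ s, f i x z := by
  classical
  induction s using Finset.induction_on with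
  | empty => simpa using BddLip.const (c := fun _ : Z => (0 : F)) 0 (by simp)
  | insert i s hi ih => simpa only [Finset.sum_insert hi] using (hf i).add ih

/-- A bounded bilinear operation preserves `BddLip`. -/
theorem bilin {F'' : Type*} [NormedAddCommGroup F''] {f : X → Z → F} {g : X → Z → F'}
    (hf : BddLip D f) (hg : BddLip D g) (B : F → F' → F'')
    (hB : ∀ u v, ‖B u v‖ ≤ ‖u‖ * ‖v‖)
    (hl : ∀ u u' v, B (u - u') v = B u v - B u' v)
    (hr : ∀ u v v', B u (v - v') = B u v - B u v') :
    BddLip D fun x z => B (f x z) (g x z) := by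
  obtain ⟨L, h0, h1, h2⟩ := hf
  obtain ⟨L', h0', h1', h2'⟩ := hg
  refine of_bounds (L * L') (2 * (L * L')) (fun x hx z => (hB _ _).trans ?_)
    fun x hx y hy z => ?_
  · exact mul_le_mul (h1 x hx z) (h1' x hx z) (norm_nonneg _) h0
  · have : B (f x z) (g x z) - B (f y z) (g y z)
        = B (f x z - f y z) (g x z) + B (f y z) (g x z - g y z) := by
      rw [hl, hr]; abel
    rw [this]
    calc _ ≤ ‖f x z - f y z‖ * ‖g x z‖ + ‖f y z‖ * ‖g x z - g y z‖ :=
          (norm_add_le _ _).trans (add_le_add (hB _ _) (hB _ _))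
      _ ≤ (L * ‖x - y‖) * L' + L * (L' * ‖x - y‖) := by
          gcongr
          exacts [h2 x hx y hy z, h1' x hx z, h1 y hy z, h2' x hx y hy z]
      _ = _ := by ring

theorem smul [NormedSpace ℝ F] {f : X → Z → ℝ} {g : X → Z → F} (hf : BddLip D f)
    (hg : BddLip D g) : BddLip D fun x z => f x z • g x z :=
  hf.bilin hg (fun u v => u • v) (fun u v => (norm_smul u v).le) (fun u u' v => sub_smul u u' v)
    (fun u v v' => smul_sub u v v')

theorem mul {f g : X → Z → ℝ} (hf : BddLip D f)
    (hg : BddLip D g) : BddLip D fun x z => f x z * g x z :=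
  hf.smul hg

theorem inner [InnerProductSpace ℝ F] {f g : X → Z → F} (hf : BddLip D f)
    (hg : BddLip D g) : BddLip D fun x z => inner ℝ (f x z) (g x z) :=
  hf.bilin hg (fun u v => Inner.inner ℝ u v) (fun u v => norm_inner_le_norm u v)
    (fun u u' v => inner_sub_left u u' v) (fun u v v' => inner_sub_right u v v')

theorem clm [NormedSpace ℝ F] [NormedSpace ℝ F'] {f : X → Z → F} (hf : BddLip D f)
    (A : F →L[ℝ] F') : BddLip D fun x z => A (f x z) := by
  obtain ⟨L, h0, h1, h2⟩ := hf
  refine of_bounds (‖A‖ * L) (‖A‖ * L) (fun x hx z => (A.le_opNorm _).trans ?_)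
    fun x hx y hy z => ?_
  · gcongr; exact h1 x hx z
  · rw [← map_sub, mul_assoc]
    refine (A.le_opNorm _).trans ?_
    gcongr; exact h2 x hx y hy z

/-- Reparametrization. -/
theorem comp {D' : Set Y} {f : X → Z → F} (hf : BddLip D f) {g : Y → X} {L : ℝ}
    (hg : ∀ x ∈ D', ∀ y ∈ D', ‖g x - g y‖ ≤ L * ‖x - y‖) (hD : ∀ y ∈ D', g y ∈ D) (e : Z' → Z) :
    BddLip D' fun y z => f (g y) (e z) := by
  obtain ⟨K, h0, h1, h2⟩ := hf
  refine of_bounds K (K * L) (fun x hx z => h1 _ (hD x hx) _)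
    fun x hx y hy z => (h2 _ (hD x hx) _ (hD y hy) _).trans ?_
  rw [mul_assoc]
  gcongr
  exact hg x hx y hy

theorem comp_right {f : X → Z → F} (hf : BddLip D f) (e : Z' → Z) :
    BddLip D fun y z => f y (e z) :=
  hf.comp (g := id) (L := 1) (by simp) (by simp) e

/-- The mean no longer depends on the second argument; the free type `Z'` keeps it in a form that
combines with families indexed by any other set. -/
theorem integral [NormedSpace ℝ F] [MeasurableSpace Z] {f : X → Z → F} (hf : BddLip D f)
    (ν : Measure Z) [IsProbabilityMeasure ν] (hm : ∀ x, AEStronglyMeasurable (f x) ν) (Z' : Type*) :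
    BddLip D fun x (_ : Z') => ∫ z, f x z ∂ν := by
  obtain ⟨L, h0, h1, h2⟩ := hf
  have hi : ∀ x ∈ D, Integrable (f x) ν := fun x hx =>
    Integrable.of_bound (hm x) L (Filter.Eventually.of_forall (h1 x hx))
  refine ⟨L, h0, fun x hx _ => ?_, fun x hx y hy _ => ?_⟩
  · simpa using norm_integral_le_of_norm_le_const (μ := ν) (Filter.Eventually.of_forall (h1 x hx))
  · rw [← integral_sub (hi x hx) (hi y hy)]
    simpa using norm_integral_le_of_norm_le_const (μ := ν)
      (Filter.Eventually.of_forall (h2 x hx y hy))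

theorem continuous [NormedSpace ℝ X] {f : X → Z → F}
    (hf : ∀ R, BddLip (Metric.closedBall 0 R) f) (z : Z) : Continuous fun x => f x z := by
  rw [continuous_iff_continuousAt]
  intro x
  obtain ⟨L, h0, -, h2⟩ := hf (‖x‖ + 1)
  have hlip : LipschitzOnWith L.toNNReal (fun x => f x z) (Metric.closedBall 0 (‖x‖ + 1)) := by
    refine LipschitzOnWith.of_dist_le_mul fun a ha b hb => ?_
    rw [dist_eq_norm, dist_eq_norm, Real.coe_toNNReal _ h0]
    exact h2 a ha b hb z
  refine hlip.continuousOn.continuousAt ?_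
  exact Metric.closedBall_mem_nhds_of_mem (by simp)

end BddLip

theorem bddLip_id {X Z : Type*} [NormedAddCommGroup X] (R : ℝ) :
    BddLip (Metric.closedBall (0 : X) R) fun x (_ : Z) => x :=
  BddLip.of_bounds R 1 (fun x hx _ => by simpa using hx) (by simp)

/-! ### Regularity of policies, values and update directions in the parameters -/

noncomputable section
namespace GreedyGQ

/-- The parameter space. -/
abbrev Param (N : ℕ) := EuclideanSpace ℝ (Fin N)

namespace Model

variable {S A : Type*} [MeasurableSpace S] [MeasurableSpace A] {N : ℕ} [Fintype A]
  {m : Model S A N} {μ : Measure (S × A)} {rmax C₀ ρ k₁ k₂ : ℝ}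

variable (m) in
/-- The gradient of the policy with respect to the parameter. -/
def targetGrad (θ : Param N) (s : S) (a : A) : Param N := gradient (fun θ' => m.target θ' s a) θ

namespace Assumptions

theorem hasGradientAt_target (hm : m.Assumptions μ rmax C₀ ρ k₁ k₂) (θ : Param N) (s : S) (a : A) :
    HasGradientAt (fun θ' => m.target θ' s a) (m.targetGrad θ s a) θ :=
  (hm.target_differentiable s a θ).hasGradientAt

theorem target_sub_le (hm : m.Assumptions μ rmax C₀ ρ k₁ k₂) (θ θ' : Param N) (s : S) (a : A) :
    |m.target θ s a - m.target θ' s a| ≤ k₁ * ‖θ - θ'‖ := by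
  have := Convex.norm_image_sub_le_of_norm_hasFDerivWithin_le (𝕜 := ℝ) (C := k₁)
    (f := fun θ' => m.target θ' s a) (s := Set.univ) (x := θ') (y := θ)
    (fun x _ => (hm.hasGradientAt_target x s a).hasFDerivAt.hasFDerivWithinAt)
    (fun x _ => by
      rw [LinearIsometryEquiv.norm_map]; exact hm.target_grad_le s a x) convex_univ trivial trivial
  simpa using this

/-- Mean value inequality for the policy minus its linearization at `θ`, on the ball around `θ` that
reaches `θ'`: there the gradients differ by at most `|k₂| * ‖θ' - θ‖`. The absolute value is needed
because no sign of `k₂` is assumed. -/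
theorem target_taylor (hm : m.Assumptions μ rmax C₀ ρ k₁ k₂) (θ θ' : Param N) (s : S) (a : A) :
    |m.target θ' s a - m.target θ s a - inner ℝ (m.targetGrad θ s a) (θ' - θ)|
      ≤ |k₂| * ‖θ' - θ‖ ^ 2 := by
  have := Convex.norm_image_sub_le_of_norm_hasFDerivWithin_le' (𝕜 := ℝ) (C := |k₂| * ‖θ' - θ‖)
    (f := fun θ' => m.target θ' s a) (s := Metric.closedBall θ ‖θ' - θ‖) (x := θ) (y := θ')
    (φ := InnerProductSpace.toDual ℝ _ (m.targetGrad θ s a))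
    (fun x _ => (hm.hasGradientAt_target x s a).hasFDerivAt.hasFDerivWithinAt)
    (fun x hx => by
      rw [← map_sub, LinearIsometryEquiv.norm_map]
      refine (hm.target_grad_lipschitz s a x θ).trans ?_
      have hx : ‖x - θ‖ ≤ ‖θ' - θ‖ := by simpa [dist_eq_norm] using hx
      exact mul_le_mul (le_abs_self _) hx (norm_nonneg _) (abs_nonneg _))
    (convex_closedBall _ _) (by simp) (by simp [dist_eq_norm])
  rw [sq, ← mul_assoc]
  simpa using this

theorem target_le_one (hm : m.Assumptions μ rmax C₀ ρ k₁ k₂) (θ : Param N) (s : S) (a : A) :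
    m.target θ s a ≤ 1 := by
  rw [← hm.target_sum θ s]
  exact Finset.single_le_sum (fun i _ => hm.target_nonneg θ s i) (Finset.mem_univ a)

theorem abs_Q_le (hm : m.Assumptions μ rmax C₀ ρ k₁ k₂) (θ : Param N) (s : S) (a : A) :
    |m.Q θ s a| ≤ ‖θ‖ := by
  refine (abs_real_inner_le_norm _ _).trans ?_
  exact mul_le_of_le_one_left (norm_nonneg _) (hm.feature_le s a)

theorem hasGradientAt_Vbar (hm : m.Assumptions μ rmax C₀ ρ k₁ k₂) (θ : Param N) (s : S) :
    HasGradientAt (m.Vbar s)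
      (∑ a, (m.Q θ s a • m.targetGrad θ s a + m.target θ s a • m.feature s a)) θ := by
  rw [hasGradientAt_iff_hasFDerivAt, map_sum]
  refine HasFDerivAt.fun_sum (A := fun a θ => m.target θ s a * m.Q θ s a) fun a _ => ?_
  have h1 := (hm.hasGradientAt_target θ s a).hasFDerivAt
  have h2 : HasFDerivAt (fun θ => m.Q θ s a) (InnerProductSpace.toDual ℝ _ (m.feature s a)) θ :=
    (InnerProductSpace.toDual ℝ _ (m.feature s a)).hasFDerivAt
  refine (h1.mul h2).congr_fderiv ?_
  rw [map_add, map_smul, map_smul, add_comm]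

theorem phiHat_eq (hm : m.Assumptions μ rmax C₀ ρ k₁ k₂) (θ : Param N) (s : S) :
    m.phiHat s θ = ∑ a, (m.Q θ s a • m.targetGrad θ s a + m.target θ s a • m.feature s a) :=
  (hm.hasGradientAt_Vbar θ s).gradient

theorem bddLip_target (hm : m.Assumptions μ rmax C₀ ρ k₁ k₂) (D : Set (Param N)) (a : A) :
    BddLip D fun θ s => m.target θ s a :=
  BddLip.of_bounds 1 k₁
    (fun θ _ s => by
      rw [Real.norm_eq_abs, abs_of_nonneg (hm.target_nonneg _ _ _)]; exact hm.target_le_one _ _ _)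
    fun θ _ θ' _ s => hm.target_sub_le θ θ' s a

theorem bddLip_targetGrad (hm : m.Assumptions μ rmax C₀ ρ k₁ k₂) (D : Set (Param N)) (a : A) :
    BddLip D fun θ s => m.targetGrad θ s a :=
  BddLip.of_bounds k₁ k₂ (fun _ _ _ => hm.target_grad_le _ _ _)
    fun θ _ θ' _ s => hm.target_grad_lipschitz s a θ θ'

theorem bddLip_feature (hm : m.Assumptions μ rmax C₀ ρ k₁ k₂) (D : Set (Param N)) :
    BddLip D fun _ (x : S × A) => m.feature x.1 x.2 :=
  BddLip.const 1 fun x => hm.feature_le x.1 x.2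

theorem bddLip_Q (hm : m.Assumptions μ rmax C₀ ρ k₁ k₂) (R : ℝ) :
    BddLip (Metric.closedBall 0 R) fun θ (x : S × A) => m.Q θ x.1 x.2 :=
  (hm.bddLip_feature _).inner (bddLip_id R)

theorem bddLip_Vbar (hm : m.Assumptions μ rmax C₀ ρ k₁ k₂) (R : ℝ) :
    BddLip (Metric.closedBall 0 R) fun θ s => m.Vbar s θ :=
  BddLip.sum _ fun a => (hm.bddLip_target _ a).mul ((hm.bddLip_Q R).comp_right fun s => (s, a))

theorem bddLip_phiHat (hm : m.Assumptions μ rmax C₀ ρ k₁ k₂) (R : ℝ) :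
    BddLip (Metric.closedBall 0 R) fun θ s => m.phiHat s θ := by
  simp only [hm.phiHat_eq]
  exact BddLip.sum _ fun a =>
    (((hm.bddLip_Q R).comp_right fun s => (s, a)).smul (hm.bddLip_targetGrad _ a)).add
    ((hm.bddLip_target _ a).smul ((hm.bddLip_feature _).comp_right fun s => (s, a)))

/-- The remainder of a product of a policy and a linear function splits, for each action, into the
remainder of the policy times the value at `θ`, and the increment of the policy times the increment
of the value. Both are quadratic in the displacement; the first is where `R` enters the constant. -/
theorem Vbar_taylor (hm : m.Assumptions μ rmax C₀ ρ k₁ k₂) (R : ℝ) :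
    ∃ L : ℝ, 0 ≤ L ∧ ∀ θ θ' : Param N, ‖θ‖ ≤ R → ‖θ'‖ ≤ R → ∀ s,
      |m.Vbar s θ' - m.Vbar s θ - inner ℝ (m.phiHat s θ) (θ' - θ)| ≤ L * ‖θ' - θ‖ ^ 2 := by
  refine ⟨∑ _a : A, (|k₂| * |R| + |k₁|), by positivity, fun θ θ' hθ hθ' s => ?_⟩
  have hsum : m.Vbar s θ' - m.Vbar s θ - inner ℝ (m.phiHat s θ) (θ' - θ) =
      ∑ a, ((m.target θ' s a - m.target θ s a - inner ℝ (m.targetGrad θ s a) (θ' - θ)) * m.Q θ s a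
        + (m.target θ' s a - m.target θ s a) * inner ℝ (m.feature s a) (θ' - θ)) := by
    rw [hm.phiHat_eq, sum_inner, Vbar, Vbar, ← Finset.sum_sub_distrib, ← Finset.sum_sub_distrib]
    refine Finset.sum_congr rfl fun a _ => ?_
    simp only [inner_add_left, real_inner_smul_left, Q, inner_sub_right]
    ring
  rw [hsum, Finset.sum_mul]
  refine (Finset.abs_sum_le_sum_abs _ _).trans (Finset.sum_le_sum fun a _ => ?_)
  refine (abs_add_le _ _).trans ?_
  rw [abs_mul, abs_mul, add_mul]
  refine add_le_add ?_ ?_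
  · have h1 := hm.target_taylor θ θ' s a
    have h2 : |m.Q θ s a| ≤ |R| := (hm.abs_Q_le θ s a).trans (hθ.trans (le_abs_self _))
    calc _ ≤ (|k₂| * ‖θ' - θ‖ ^ 2) * |R| := by gcongr
      _ = _ := by ring
  · have h1 := hm.target_sub_le θ' θ s a
    have h2 : |inner ℝ (m.feature s a) (θ' - θ)| ≤ ‖θ' - θ‖ := hm.abs_Q_le (θ' - θ) s a
    calc _ ≤ (|k₁| * ‖θ' - θ‖) * ‖θ' - θ‖ := by
          gcongr; exact h1.trans (by gcongr; exact le_abs_self _)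
      _ = _ := by ring

end Assumptions

variable (m) in
/-- The feature vector of the state-action pair of a transition. -/
def transFeature (z : S × A × S) : Param N := m.feature z.1 z.2.1

variable (m) in
/-- The temporal difference error of a transition. -/
def tdError (θ : Param N) (z : S × A × S) : ℝ := m.δ z.1 z.2.1 z.2.2 θ

variable (m) in
/-- The update direction of the main iterate, as a function of `(θ, ω)` and of the transition. -/
def mainDir (x : Param N × Param N) (z : S × A × S) : Param N :=
  m.tdError x.1 z • m.transFeature z
    - (m.γ * inner ℝ x.2 (m.transFeature z)) • m.phiHat z.2.2 x.1

variable (m) in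
/-- The update direction of the auxiliary iterate. -/
def auxDir (x : Param N × Param N) (z : S × A × S) : Param N :=
  (m.tdError x.1 z - inner ℝ (m.transFeature z) x.2) • m.transFeature z

namespace Assumptions

theorem bddLip_transFeature (hm : m.Assumptions μ rmax C₀ ρ k₁ k₂) {X : Type*}
    [NormedAddCommGroup X] (D : Set X) :
    BddLip D fun _ z => m.transFeature z :=
  BddLip.const 1 fun z => hm.feature_le z.1 z.2.1

theorem bddLip_reward (hm : m.Assumptions μ rmax C₀ ρ k₁ k₂) {X : Type*}
    [NormedAddCommGroup X] (D : Set X) :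
    BddLip D fun _ (z : S × A × S) => m.reward z.1 z.2.1 z.2.2 :=
  BddLip.const rmax fun z => by
    rw [Real.norm_eq_abs, abs_of_nonneg (hm.reward_nonneg _ _ _)]; exact hm.reward_le _ _ _

theorem bddLip_tdError (hm : m.Assumptions μ rmax C₀ ρ k₁ k₂) (R : ℝ) :
    BddLip (Metric.closedBall 0 R) m.tdError := by
  have h1 := hm.bddLip_reward (Metric.closedBall (0 : Param N) R)
  have h2 : BddLip (Metric.closedBall (0 : Param N) R) fun _ (_ : S × A × S) => m.γ :=
    BddLip.const |m.γ| (by simp)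
  have h3 := (hm.bddLip_Vbar R).comp_right fun z : S × A × S => z.2.2
  have h4 := (hm.bddLip_Q R).comp_right fun z : S × A × S => (z.1, z.2.1)
  exact (h1.add (h2.mul h3)).sub h4

theorem _root_.BddLip.comp_fst {X Y Z F : Type*} [NormedAddCommGroup X] [NormedAddCommGroup Y]
    [NormedAddCommGroup F] {R : ℝ}
    {f : X → Z → F} (hf : BddLip (Metric.closedBall 0 R) f) :
    BddLip (Metric.closedBall (0 : X × Y) R) fun x z => f x.1 z :=
  hf.comp (g := Prod.fst) (L := 1) (fun x _ y _ => by simpa using norm_fst_le (x - y))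
    (fun x hx => by
      have := norm_fst_le x
      simp only [mem_closedBall_zero_iff] at hx ⊢
      exact this.trans hx) id

theorem _root_.BddLip.comp_snd {X Y Z F : Type*} [NormedAddCommGroup X] [NormedAddCommGroup Y]
    [NormedAddCommGroup F] {R : ℝ}
    {f : Y → Z → F} (hf : BddLip (Metric.closedBall 0 R) f) :
    BddLip (Metric.closedBall (0 : X × Y) R) fun x z => f x.2 z :=
  hf.comp (g := Prod.snd) (L := 1) (fun x _ y _ => by simpa using norm_snd_le (x - y))
    (fun x hx => by
      have := norm_snd_le x
      simp only [mem_closedBall_zero_iff] at hx ⊢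
      exact this.trans hx) id

theorem bddLip_mainDir (hm : m.Assumptions μ rmax C₀ ρ k₁ k₂) (R : ℝ) :
    BddLip (Metric.closedBall 0 R) m.mainDir := by
  have h1 := (hm.bddLip_tdError R).comp_fst (Y := Param N)
  have h2 := hm.bddLip_transFeature (Metric.closedBall (0 : Param N × Param N) R)
  have h3 : BddLip (Metric.closedBall (0 : Param N × Param N) R) fun _ (_ : S × A × S) => m.γ :=
    BddLip.const |m.γ| (by simp)
  have h4 := (bddLip_id (X := Param N) (Z := S × A × S) R).comp_snd (X := Param N)
  have h5 := ((hm.bddLip_phiHat R).comp_fst (Y := Param N)).comp_right fun z : S × A × S => z.2.2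
  exact (h1.smul h2).sub ((h3.mul (h4.inner h2)).smul h5)

theorem bddLip_auxDir (hm : m.Assumptions μ rmax C₀ ρ k₁ k₂) (R : ℝ) :
    BddLip (Metric.closedBall 0 R) m.auxDir := by
  have h1 := (hm.bddLip_tdError R).comp_fst (Y := Param N)
  have h2 := hm.bddLip_transFeature (Metric.closedBall (0 : Param N × Param N) R)
  have h4 := (bddLip_id (X := Param N) (Z := S × A × S) R).comp_snd (X := Param N)
  exact (h1.sub (h2.inner h4)).smul h2

end Assumptions
end Model
end GreedyGQ
end

/-! ### Joint measurability of the directions and of the iterates -/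

noncomputable section
namespace GreedyGQ
namespace Model

variable {S A : Type*} [MeasurableSpace S] [MeasurableSpace A] {N : ℕ} [Fintype A]
  {m : Model S A N} {μ : Measure (S × A)} {rmax C₀ ρ k₁ k₂ : ℝ}

namespace Assumptions

theorem measurable_target (hm : m.Assumptions μ rmax C₀ ρ k₁ k₂) (a : A) :
    Measurable fun x : Param N × S => m.target x.1 x.2 a :=
  measurable_uncurry_of_continuous_of_measurable (u := fun θ s => m.target θ s a)
    (fun s => (hm.target_differentiable s a).continuous) fun θ => hm.target_measurable θ a

/-- Each component of the gradient is a pointwise limit of difference quotients of the policy, which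
is jointly measurable as a function continuous in the parameter and measurable in the state. -/
theorem measurable_targetGrad (hm : m.Assumptions μ rmax C₀ ρ k₁ k₂) (a : A) :
    Measurable fun x : Param N × S => m.targetGrad x.1 x.2 a := by
  have hcoord : ∀ v : Param N, Measurable fun x : Param N × S =>
      inner ℝ (m.targetGrad x.1 x.2 a) v := by
    intro v
    refine measurable_of_tendsto_metrizable (f := fun (n : ℕ) (x : Param N × S) =>
      (n : ℝ) * (m.target (x.1 + (n : ℝ)⁻¹ • v) x.2 a - m.target x.1 x.2 a)) (fun n => ?_) ?_
    · have h1 : Measurable fun x : Param N × S => (x.1 + (n : ℝ)⁻¹ • v, x.2) := by fun_prop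
      exact (((hm.measurable_target a).comp h1).sub (hm.measurable_target a)).const_mul _
    · rw [tendsto_pi_nhds]
      intro x
      have h := (hm.hasGradientAt_target x.1 x.2 a).hasFDerivAt.lim v
        (c := fun n : ℕ => (n : ℝ)) (l := Filter.atTop)
        (by simpa using tendsto_natCast_atTop_atTop (R := ℝ))
      simpa using h
  have h := EuclideanSpace.basisFun (Fin N) ℝ
  have hsum : (fun x : Param N × S => m.targetGrad x.1 x.2 a) =
      fun x => ∑ i, inner ℝ (m.targetGrad x.1 x.2 a) (h i) • h i := by
    funext x
    conv_lhs => rw [← h.sum_repr' (m.targetGrad x.1 x.2 a)]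
    simp_rw [real_inner_comm]
  rw [hsum]
  exact Finset.measurable_fun_sum _ fun i _ => (hcoord (h i)).smul_const (h i)

theorem measurable_feature_right (hm : m.Assumptions μ rmax C₀ ρ k₁ k₂) (a : A) :
    Measurable fun x : Param N × S => m.feature x.2 a := by
  have h : Measurable fun x : Param N × S => (x.2, a) := by fun_prop
  exact hm.feature_measurable.comp h

theorem measurable_Q_right (hm : m.Assumptions μ rmax C₀ ρ k₁ k₂) (a : A) :
    Measurable fun x : Param N × S => m.Q x.1 x.2 a :=
  (hm.measurable_feature_right a).inner measurable_fst

theorem measurable_Vbar (hm : m.Assumptions μ rmax C₀ ρ k₁ k₂) :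
    Measurable fun x : Param N × S => m.Vbar x.2 x.1 :=
  Finset.measurable_fun_sum _ fun a _ => (hm.measurable_target a).mul (hm.measurable_Q_right a)

theorem measurable_phiHat (hm : m.Assumptions μ rmax C₀ ρ k₁ k₂) :
    Measurable fun x : Param N × S => m.phiHat x.2 x.1 := by
  simp only [hm.phiHat_eq]
  exact Finset.measurable_fun_sum _ fun a _ =>
    ((hm.measurable_Q_right a).smul (hm.measurable_targetGrad a)).add
      ((hm.measurable_target a).smul (hm.measurable_feature_right a))

theorem measurable_phiHat_comp (hm : m.Assumptions μ rmax C₀ ρ k₁ k₂) {W : Type*}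
    [MeasurableSpace W] {f : W → Param N} {g : W → S} (hf : Measurable f) (hg : Measurable g) :
    Measurable fun w => m.phiHat (g w) (f w) := by
  simpa only [Function.comp_def] using hm.measurable_phiHat.comp (hf.prodMk hg)

theorem measurable_transFeature (hm : m.Assumptions μ rmax C₀ ρ k₁ k₂) :
    Measurable m.transFeature := by
  have h : Measurable fun z : S × A × S => (z.1, z.2.1) := by fun_prop
  exact hm.feature_measurable.comp h

theorem measurable_tdError (hm : m.Assumptions μ rmax C₀ ρ k₁ k₂) :
    Measurable fun x : Param N × S × A × S => m.tdError x.1 x.2 := by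
  have h1 : Measurable fun x : Param N × S × A × S => (x.1, x.2.2.2) := by fun_prop
  exact ((hm.reward_measurable.comp measurable_snd).add
    ((hm.measurable_Vbar.comp h1).const_mul m.γ)).sub
    ((hm.measurable_transFeature.comp measurable_snd).inner measurable_fst)

theorem measurable_mainDir (hm : m.Assumptions μ rmax C₀ ρ k₁ k₂) :
    Measurable fun x : (Param N × Param N) × S × A × S => m.mainDir x.1 x.2 := by
  have h1 : Measurable fun x : (Param N × Param N) × S × A × S => (x.1.1, x.2) := by fun_prop
  have h2 : Measurable fun x : (Param N × Param N) × S × A × S => (x.1.1, x.2.2.2) := by fun_prop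
  have h3 : Measurable fun x : (Param N × Param N) × S × A × S => x.1.2 := by fun_prop
  have h4 : Measurable fun x : (Param N × Param N) × S × A × S => m.transFeature x.2 :=
    hm.measurable_transFeature.comp measurable_snd
  have h5 : Measurable fun x : (Param N × Param N) × S × A × S => m.tdError x.1.1 x.2 :=
    hm.measurable_tdError.comp h1
  have h6 : Measurable fun x : (Param N × Param N) × S × A × S => m.phiHat x.2.2.2 x.1.1 :=
    hm.measurable_phiHat_comp h2.fst h2.snd
  have h7 : Measurable fun x : (Param N × Param N) × S × A × S =>
    m.γ * inner ℝ x.1.2 (m.transFeature x.2) := (h3.inner h4).const_mul m.γ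
  unfold mainDir
  exact (h5.smul h4).sub (h7.smul h6)

theorem measurable_auxDir (hm : m.Assumptions μ rmax C₀ ρ k₁ k₂) :
    Measurable fun x : (Param N × Param N) × S × A × S => m.auxDir x.1 x.2 := by
  have h1 : Measurable fun x : (Param N × Param N) × S × A × S => (x.1.1, x.2) := by fun_prop
  have h3 : Measurable fun x : (Param N × Param N) × S × A × S => x.1.2 := by fun_prop
  have h4 : Measurable fun x : (Param N × Param N) × S × A × S => m.transFeature x.2 :=
    hm.measurable_transFeature.comp measurable_snd
  exact ((hm.measurable_tdError.comp h1).sub (h4.inner h3)).smul h4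

end Assumptions

theorem iter_succ (α β : ℕ → ℝ) (θ₀ ω₀ : Param N) (s : ℕ → S) (act : ℕ → A) (t : ℕ) :
    m.iter α β θ₀ ω₀ s act (t + 1) =
      ((m.iter α β θ₀ ω₀ s act t).1 +
          α t • m.mainDir (m.iter α β θ₀ ω₀ s act t) (s t, act t, s (t + 1)),
        (m.iter α β θ₀ ω₀ s act t).2 +
          β t • m.auxDir (m.iter α β θ₀ ω₀ s act t) (s t, act t, s (t + 1))) :=
  rfl

theorem iter_congr (α β : ℕ → ℝ) (θ₀ ω₀ : Param N) {s s' : ℕ → S} {act act' : ℕ → A} (t : ℕ)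
    (hs : ∀ i ≤ t, s i = s' i) (ha : ∀ i < t, act i = act' i) :
    m.iter α β θ₀ ω₀ s act t = m.iter α β θ₀ ω₀ s' act' t := by
  induction t with
  | zero => rfl
  | succ t ih =>
    rw [iter_succ, iter_succ, ih (fun i hi => hs i (by omega)) (fun i hi => ha i (by omega)),
      hs t (by omega), hs (t + 1) le_rfl, ha t (by omega)]

namespace Assumptions

theorem measurable_iter (hm : m.Assumptions μ rmax C₀ ρ k₁ k₂) (α β : ℕ → ℝ) (θ₀ ω₀ : Param N)
    (t : ℕ) : Measurable fun p : ℕ → S × A =>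
      m.iter α β θ₀ ω₀ (fun i => (p i).1) (fun i => (p i).2) t := by
  induction t with
  | zero => exact measurable_const
  | succ t ih =>
    simp only [iter_succ]
    have h : Measurable fun p : ℕ → S × A =>
        (m.iter α β θ₀ ω₀ (fun i => (p i).1) (fun i => (p i).2) t,
          (p t).1, (p t).2, (p (t + 1)).1) := by fun_prop
    exact (ih.fst.add ((hm.measurable_mainDir.comp h).const_smul (α t))).prodMk
      (ih.snd.add ((hm.measurable_auxDir.comp h).const_smul (β t)))

/-- The iterate at time `t` is a measurable function of the history up to time `t`. -/
theorem exists_iter_eq_history (hm : m.Assumptions μ rmax C₀ ρ k₁ k₂) (α β : ℕ → ℝ)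
    (θ₀ ω₀ : Param N) (t : ℕ) :
    ∃ F : (Fin t → S × A) × S → Param N × Param N, Measurable F ∧
      ∀ (s : ℕ → S) (act : ℕ → A),
        m.iter α β θ₀ ω₀ s act t = F (fun i => (s i, act i), s t) := by
  have := hm.probability
  obtain ⟨x₀⟩ : Nonempty (S × A) := μ.nonempty_of_neZero
  -- The history is padded to an infinite path by repeating the last state with an arbitrary action.
  -- The padding is never read: the iterate at time `t` uses states up to `t` and actions only
  -- before `t`.
  let ext : (Fin t → S × A) × S → ℕ → S × A := fun h i =>
    if hi : i < t then h.1 ⟨i, hi⟩ else (h.2, x₀.2)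
  have hext : Measurable ext := by
    refine measurable_pi_lambda _ fun i => ?_
    by_cases hi : i < t
    · simp only [ext, hi, dite_true]; fun_prop
    · simp only [ext, hi, dite_false]; fun_prop
  refine ⟨_, (hm.measurable_iter α β θ₀ ω₀ t).comp hext, fun s act => ?_⟩
  refine iter_congr α β θ₀ ω₀ t (fun i hi => ?_) fun i hi => ?_
  · by_cases h : i < t
    · simp [ext, h]
    · obtain rfl : i = t := by omega
      simp [ext]
  · simp [ext, hi]

end Assumptions
end Model
end GreedyGQ
end

/-! ### Stationary law, covariance operator and projection -/

noncomputable section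
namespace GreedyGQ
namespace Model

variable {S A : Type*} [MeasurableSpace S] [MeasurableSpace A] {N : ℕ}
  {m : Model S A N} {μ : Measure (S × A)} {rmax C₀ ρ k₁ k₂ : ℝ}

variable (m μ) in
/-- The stationary law of the transition `(s, a, s')`. -/
def stationary : Measure (S × A × S) := (μ.map Prod.fst) ⊗ₘ m.stepKernel

variable (m μ) in
/-- The operator `v ↦ E_μ[⟨φ, v⟩ φ]`. -/
def covOp (v : Param N) : Param N :=
  ∫ x, m.Q v x.1 x.2 • m.feature x.1 x.2 ∂μ

/-- One step of the pair chain redraws the action from the behavior policy given the new state. An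
invariant law is the law after such a step, hence inherits this disintegration. -/
theorem invariant_eq_compProd [IsMarkovKernel m.trans] [IsMarkovKernel m.behavior]
    [IsProbabilityMeasure μ] (h : Kernel.Invariant m.pairKernel μ) :
    (μ.map Prod.fst) ⊗ₘ m.behavior = μ := by
  have key : μ = (μ.bind m.trans) ⊗ₘ m.behavior := by
    refine Measure.ext_of_lintegral _ fun f hf => ?_
    conv_lhs => rw [← h.def]
    rw [Measure.lintegral_bind (Kernel.aemeasurable _) hf.aemeasurable,
      Measure.lintegral_compProd hf,
      Measure.lintegral_bind (Kernel.aemeasurable _)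
        (by exact (hf.lintegral_kernel_prod_right').aemeasurable)]
    refine lintegral_congr fun x => ?_
    rw [pairKernel, Kernel.lintegral_compProd _ _ _ hf]
    simp [Kernel.comap_apply]
  have hfst : μ.map Prod.fst = μ.bind m.trans := by
    conv_lhs => rw [key]
    exact Measure.fst_compProd _ _
  rw [hfst, ← key]

variable [Fintype A]

namespace Assumptions

theorem isMarkovKernel_stepKernel (hm : m.Assumptions μ rmax C₀ ρ k₁ k₂) :
    IsMarkovKernel m.stepKernel := by
  have := hm.trans_markov
  have := hm.behavior_markov
  unfold stepKernel
  infer_instance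

theorem isMarkovKernel_stateKernel (hm : m.Assumptions μ rmax C₀ ρ k₁ k₂) :
    IsMarkovKernel m.stateKernel := by
  have := hm.isMarkovKernel_stepKernel
  unfold stateKernel
  infer_instance

theorem isProbabilityMeasure_stationary (hm : m.Assumptions μ rmax C₀ ρ k₁ k₂) :
    IsProbabilityMeasure (m.stationary μ) := by
  have := hm.isMarkovKernel_stepKernel
  have := hm.probability
  have : IsProbabilityMeasure (μ.map Prod.fst) :=
    Measure.isProbabilityMeasure_map measurable_fst.aemeasurable
  unfold stationary
  infer_instance

/-- Associativity of composition products: drawing the state and then the pair (action, next state)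
is the same as drawing the state-action pair from `μ` and then the next state. The first description
suits the state chain, the second the Bellman operator. -/
theorem stationary_eq_map (hm : m.Assumptions μ rmax C₀ ρ k₁ k₂) :
    m.stationary μ = (μ ⊗ₘ m.trans).map MeasurableEquiv.prodAssoc := by
  have := hm.trans_markov
  have := hm.behavior_markov
  have := hm.probability
  conv_rhs => rw [← invariant_eq_compProd hm.invariant]
  exact Measure.compProd_assoc'.symm

theorem integral_stationary (hm : m.Assumptions μ rmax C₀ ρ k₁ k₂) {F : Type*}
    [NormedAddCommGroup F] [NormedSpace ℝ F] {f : S × A × S → F}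
    (hf : Integrable f (m.stationary μ)) :
    ∫ z, f z ∂(m.stationary μ) = ∫ x, ∫ s', f (x.1, x.2, s') ∂(m.trans x) ∂μ := by
  have := hm.trans_markov
  have := hm.probability
  rw [hm.stationary_eq_map] at hf ⊢
  rw [integrable_map_equiv] at hf
  rw [integral_map_equiv]
  exact Measure.integral_compProd hf

theorem integrable_stationary (hm : m.Assumptions μ rmax C₀ ρ k₁ k₂) {F : Type*}
    [NormedAddCommGroup F] [MeasurableSpace F] [BorelSpace F] [SecondCountableTopology F]
    {f : S × A × S → F}
    (hf : Measurable f) (B : ℝ) (hB : ∀ z, ‖f z‖ ≤ B) : Integrable f (m.stationary μ) := by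
  have := hm.isProbabilityMeasure_stationary
  exact Integrable.of_bound hf.aestronglyMeasurable B (Filter.Eventually.of_forall hB)

theorem integrable_pair (hm : m.Assumptions μ rmax C₀ ρ k₁ k₂) {F : Type*}
    [NormedAddCommGroup F] [MeasurableSpace F] [BorelSpace F] [SecondCountableTopology F]
    {f : S × A → F}
    (hf : Measurable f) (B : ℝ) (hB : ∀ z, ‖f z‖ ≤ B) : Integrable f μ := by
  have := hm.probability
  exact Integrable.of_bound hf.aestronglyMeasurable B (Filter.Eventually.of_forall hB)

theorem measurable_Q (hm : m.Assumptions μ rmax C₀ ρ k₁ k₂) (v : Param N) :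
    Measurable fun x : S × A => m.Q v x.1 x.2 :=
  hm.feature_measurable.inner measurable_const

theorem integrable_Q_smul (hm : m.Assumptions μ rmax C₀ ρ k₁ k₂) (v : Param N) :
    Integrable (fun x : S × A => m.Q v x.1 x.2 • m.feature x.1 x.2) μ :=
  hm.integrable_pair ((hm.measurable_Q v).smul hm.feature_measurable) ‖v‖ fun x => by
    rw [norm_smul, Real.norm_eq_abs]
    exact (mul_le_of_le_one_right (abs_nonneg _) (hm.feature_le _ _)).trans (hm.abs_Q_le _ _ _)

theorem integrable_Q_mul (hm : m.Assumptions μ rmax C₀ ρ k₁ k₂) {f : S × A → ℝ}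
    (hf : Measurable f) {B : ℝ} (hB : ∀ x, |f x| ≤ B) (v : Param N) :
    Integrable (fun x : S × A => m.Q v x.1 x.2 * f x) μ :=
  hm.integrable_pair ((hm.measurable_Q v).mul hf) (‖v‖ * B) fun x => by
    rw [norm_mul]
    exact mul_le_mul (hm.abs_Q_le _ _ _) (hB x) (abs_nonneg _) (norm_nonneg _)

theorem inner_covOp (hm : m.Assumptions μ rmax C₀ ρ k₁ k₂) (u v : Param N) :
    inner ℝ u (m.covOp μ v) = ∫ x, m.Q u x.1 x.2 * m.Q v x.1 x.2 ∂μ := by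
  rw [covOp, ← integral_inner (hm.integrable_Q_smul v)]
  refine integral_congr_ae (Filter.Eventually.of_forall fun x => ?_)
  simp only [Q, real_inner_smul_right, real_inner_comm u]
  ring

theorem covOp_symm (hm : m.Assumptions μ rmax C₀ ρ k₁ k₂) (u v : Param N) :
    inner ℝ u (m.covOp μ v) = inner ℝ (m.covOp μ u) v := by
  rw [real_inner_comm v, hm.inner_covOp, hm.inner_covOp]
  simp_rw [mul_comm]

theorem covOp_add (hm : m.Assumptions μ rmax C₀ ρ k₁ k₂) (u v : Param N) :
    m.covOp μ (u + v) = m.covOp μ u + m.covOp μ v := by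
  rw [covOp, covOp, covOp, ← integral_add (hm.integrable_Q_smul u) (hm.integrable_Q_smul v)]
  simp only [Q, inner_add_right, add_smul]

theorem covOp_smul (_hm : m.Assumptions μ rmax C₀ ρ k₁ k₂) (c : ℝ) (v : Param N) :
    m.covOp μ (c • v) = c • m.covOp μ v := by
  rw [covOp, covOp, ← integral_smul]
  simp only [Q, real_inner_smul_right, smul_smul]

theorem covOp_eq_mulVec (hm : m.Assumptions μ rmax C₀ ρ k₁ k₂) (v : Param N) (i : Fin N) :
    m.covOp μ v i = (m.featureCov μ).mulVec v.ofLp i := by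
  have hcoord : ∀ j, Measurable fun x : S × A => m.feature x.1 x.2 j := fun j => by
    have := hm.feature_measurable
    fun_prop
  have hb : ∀ j (x : S × A), |m.feature x.1 x.2 j| ≤ 1 := fun j x =>
    (PiLp.norm_apply_le (m.feature x.1 x.2) j).trans (hm.feature_le _ _)
  have h1 : m.covOp μ v i = inner ℝ (EuclideanSpace.single i (1 : ℝ)) (m.covOp μ v) := by
    rw [EuclideanSpace.inner_single_left]; simp
  rw [h1, hm.inner_covOp, Matrix.mulVec, dotProduct]
  simp only [featureCov, Matrix.of_apply, ← integral_mul_const]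
  rw [← integral_finsetSum]
  · refine integral_congr_ae (Filter.Eventually.of_forall fun x => ?_)
    simp only [Q, PiLp.inner_apply]
    simp [Finset.mul_sum]
    refine Finset.sum_congr rfl fun j _ => by ring
  · intro j _
    refine Integrable.mul_const (hm.integrable_pair ((hcoord i).mul (hcoord j)) 1 fun x => ?_) _
    exact (norm_mul _ _).trans_le (mul_le_one₀ (hb i x) (norm_nonneg _) (hb j x))

end Assumptions

variable (m μ) in
/-- The operator `C⁻¹`. -/
def covInv : Param N →L[ℝ] Param N :=
  LinearMap.toContinuousLinearMap (Matrix.toEuclideanLin (m.featureCov μ)⁻¹)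

namespace Assumptions

theorem covOp_covInv (hm : m.Assumptions μ rmax C₀ ρ k₁ k₂) (v : Param N) :
    m.covOp μ (m.covInv μ v) = v := by
  ext i
  rw [hm.covOp_eq_mulVec]
  simp [covInv, Matrix.toLpLin_apply, Matrix.mulVec_mulVec,
    Matrix.mul_nonsing_inv _ hm.nonsingular]

theorem covInv_covOp (hm : m.Assumptions μ rmax C₀ ρ k₁ k₂) (v : Param N) :
    m.covInv μ (m.covOp μ v) = v := by
  have h : (m.covOp μ v).ofLp = (m.featureCov μ).mulVec v.ofLp :=
    funext (hm.covOp_eq_mulVec v)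
  ext i
  simp [covInv, Matrix.toLpLin_apply, h, Matrix.mulVec_mulVec,
    Matrix.nonsing_inv_mul _ hm.nonsingular]

theorem covInv_symm (hm : m.Assumptions μ rmax C₀ ρ k₁ k₂) (u v : Param N) :
    inner ℝ u (m.covInv μ v) = inner ℝ (m.covInv μ u) v := by
  conv_lhs => rw [← hm.covOp_covInv u, ← hm.covOp_symm, hm.covOp_covInv]

/-- This is C² ≤ C, valid because the features have norm at most one. With w = Cv, ‖w‖² = E[Q_w Q_v]
is at most half of E[Q_w²] + E[Q_v²], and E[Q_w²] ≤ ‖w‖². -/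
theorem norm_covOp_sq_le (hm : m.Assumptions μ rmax C₀ ρ k₁ k₂) (v : Param N) :
    ‖m.covOp μ v‖ ^ 2 ≤ inner ℝ v (m.covOp μ v) := by
  have hi : ∀ u w : Param N, Integrable (fun x : S × A => m.Q u x.1 x.2 * m.Q w x.1 x.2) μ :=
    fun u w => hm.integrable_Q_mul (hm.measurable_Q w) (fun x => hm.abs_Q_le w _ _) u
  set w := m.covOp μ v with hw
  have := hm.probability
  have h1 : ‖w‖ ^ 2 = ∫ x, m.Q w x.1 x.2 * m.Q v x.1 x.2 ∂μ := by
    rw [← hm.inner_covOp, ← hw, real_inner_self_eq_norm_sq]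
  have h2 : ∫ x, m.Q w x.1 x.2 * m.Q w x.1 x.2 ∂μ ≤ ‖w‖ ^ 2 := by
    have : ∀ x : S × A, m.Q w x.1 x.2 * m.Q w x.1 x.2 ≤ ‖w‖ ^ 2 := fun x => by
      rw [← sq, ← sq_abs]
      gcongr
      exact hm.abs_Q_le _ _ _
    simpa using integral_mono (hi w w) (integrable_const _) this
  have h3 : 2 * ∫ x, m.Q w x.1 x.2 * m.Q v x.1 x.2 ∂μ ≤
      ∫ x, m.Q w x.1 x.2 * m.Q w x.1 x.2 ∂μ + ∫ x, m.Q v x.1 x.2 * m.Q v x.1 x.2 ∂μ := by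
    rw [← integral_add (hi w w) (hi v v), ← integral_const_mul]
    refine integral_mono ((hi w v).const_mul 2) ((hi w w).add (hi v v)) fun x => ?_
    simp only
    nlinarith [sq_nonneg (m.Q w x.1 x.2 - m.Q v x.1 x.2)]
  rw [hm.inner_covOp]
  linarith

theorem covOp_pos (hm : m.Assumptions μ rmax C₀ ρ k₁ k₂) :
    ∃ lam : ℝ, 0 < lam ∧ ∀ v, lam * ‖v‖ ^ 2 ≤ inner ℝ v (m.covOp μ v) := by
  -- Coercivity follows from ‖v‖ ≤ ‖C⁻¹‖‖Cv‖ and C² ≤ C, without spectral theory. The added 1 keeps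
  -- the constant positive when `N = 0`, where C⁻¹ has norm zero.
  refine ⟨1 / (‖m.covInv μ‖ ^ 2 + 1), by positivity, fun v => ?_⟩
  rw [one_div, inv_mul_le_iff₀ (by positivity)]
  have h1 : ‖v‖ ≤ ‖m.covInv μ‖ * ‖m.covOp μ v‖ := by
    conv_lhs => rw [← hm.covInv_covOp v]
    exact (m.covInv μ).le_opNorm _
  have h2 := hm.norm_covOp_sq_le v
  calc ‖v‖ ^ 2 ≤ (‖m.covInv μ‖ * ‖m.covOp μ v‖) ^ 2 := by gcongr
    _ = ‖m.covInv μ‖ ^ 2 * ‖m.covOp μ v‖ ^ 2 := by ring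
    _ ≤ (‖m.covInv μ‖ ^ 2 + 1) * inner ℝ v (m.covOp μ v) := by
      gcongr
      linarith

/-- Completing the square around w = C⁻¹E[fφ] leaves the excess ⟨v - w, C(v - w)⟩, which is
coercive. Uniqueness of the minimizer is what identifies the arbitrary choice made in `proj`. -/
theorem isBestApprox_iff (hm : m.Assumptions μ rmax C₀ ρ k₁ k₂) {f : S → A → ℝ}
    (hf : Measurable fun x : S × A => f x.1 x.2) {B : ℝ} (hB : ∀ s a, |f s a| ≤ B) (u : Param N) :
    m.IsBestApprox μ f u ↔ u = m.covInv μ (∫ x, f x.1 x.2 • m.feature x.1 x.2 ∂μ) := by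
  set c := ∫ x, f x.1 x.2 • m.feature x.1 x.2 ∂μ with hc
  have hfφ : Integrable (fun x : S × A => f x.1 x.2 • m.feature x.1 x.2) μ :=
    hm.integrable_pair (hf.smul hm.feature_measurable) B fun x => by
      rw [norm_smul]
      exact (mul_le_of_le_one_right (norm_nonneg _) (hm.feature_le _ _)).trans (hB _ _)
  have hff : Integrable (fun x : S × A => f x.1 x.2 ^ 2) μ :=
    hm.integrable_pair (hf.pow_const 2) (B ^ 2) fun x => by
      rw [norm_pow]
      gcongr
      exact hB _ _
  have hexp : ∀ v, ∫ x, (m.Q v x.1 x.2 - f x.1 x.2) ^ 2 ∂μ =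
      inner ℝ v (m.covOp μ v) - 2 * inner ℝ v c + ∫ x, f x.1 x.2 ^ 2 ∂μ := by
    intro v
    have h1 := hm.integrable_Q_mul (hm.measurable_Q v) (fun x => hm.abs_Q_le v _ _) v
    have h2 := (hm.integrable_Q_mul hf (fun x => hB x.1 x.2) v).const_mul 2
    have h3 : inner ℝ v c = ∫ x, m.Q v x.1 x.2 * f x.1 x.2 ∂μ := by
      rw [hc, ← integral_inner hfφ]
      refine integral_congr_ae (Filter.Eventually.of_forall fun x => ?_)
      simp only [Q, real_inner_smul_right, real_inner_comm v]
      ring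
    have h12 : Integrable (fun x : S × A =>
        m.Q v x.1 x.2 * m.Q v x.1 x.2 - 2 * (m.Q v x.1 x.2 * f x.1 x.2)) μ := h1.sub h2
    rw [hm.inner_covOp, h3, ← integral_const_mul, ← integral_sub h1 h2, ← integral_add h12 hff]
    refine integral_congr_ae (Filter.Eventually.of_forall fun x => ?_)
    ring
  set w := m.covInv μ c with hw
  have hcw : c = m.covOp μ w := (hm.covOp_covInv c).symm
  have hdiff : ∀ v, ∫ x, (m.Q v x.1 x.2 - f x.1 x.2) ^ 2 ∂μ =
      ∫ x, (m.Q w x.1 x.2 - f x.1 x.2) ^ 2 ∂μ + inner ℝ (v - w) (m.covOp μ (v - w)) := by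
    intro v
    have hsub : m.covOp μ (v - w) = m.covOp μ v - m.covOp μ w := by
      rw [eq_sub_iff_add_eq, ← hm.covOp_add, sub_add_cancel]
    rw [hexp, hexp, hsub, hcw]
    simp only [inner_sub_left, inner_sub_right]
    have : inner ℝ w (m.covOp μ v) = inner ℝ v (m.covOp μ w) := by
      rw [hm.covOp_symm, real_inner_comm]
    rw [this]
    ring
  obtain ⟨lam, hlam, hpos⟩ := hm.covOp_pos
  constructor
  · intro h
    have h1 := h w
    rw [hdiff u] at h1
    have h2 := hpos (u - w)
    have h3 : ‖u - w‖ ^ 2 ≤ 0 := by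
      by_contra! h3
      nlinarith [mul_pos hlam h3]
    rw [← sub_eq_zero, ← norm_eq_zero]
    exact pow_eq_zero_iff two_ne_zero |>.1 (le_antisymm h3 (sq_nonneg _))
  · rintro rfl v
    rw [hdiff v]
    have h2 := hpos (v - w)
    have : 0 ≤ lam * ‖v - w‖ ^ 2 := by positivity
    linarith

theorem proj_eq (hm : m.Assumptions μ rmax C₀ ρ k₁ k₂) {f : S → A → ℝ}
    (hf : Measurable fun x : S × A => f x.1 x.2) {B : ℝ} (hB : ∀ s a, |f s a| ≤ B) :
    m.proj μ f = m.Q (m.covInv μ (∫ x, f x.1 x.2 • m.feature x.1 x.2 ∂μ)) := by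
  rw [proj, (hm.isBestApprox_iff hf hB _).1
    (Classical.epsilon_spec ⟨_, (hm.isBestApprox_iff hf hB _).2 rfl⟩)]

end Assumptions
end Model
end GreedyGQ
end

/-! ### The objective as a quadratic form, and its gradient -/

noncomputable section
namespace GreedyGQ
namespace Model

variable {S A : Type*} [MeasurableSpace S] [MeasurableSpace A] {N : ℕ} [Fintype A]
  {m : Model S A N} {μ : Measure (S × A)} {rmax C₀ ρ k₁ k₂ : ℝ}

variable (m μ) in
/-- `E[δ(θ) φ]` under the stationary law. -/
def meanTd (θ : Param N) : Param N := ∫ z, m.tdError θ z • m.transFeature z ∂(m.stationary μ)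

variable (m μ) in
/-- The stationary value `ω(θ) = C⁻¹ E[δ(θ) φ]` of the auxiliary iterate. -/
def auxTarget (θ : Param N) : Param N := m.covInv μ (m.meanTd μ θ)

variable (m μ) in
/-- The mean of the main direction under the stationary law. -/
def meanMainDir (x : Param N × Param N) : Param N := ∫ z, m.mainDir x z ∂(m.stationary μ)

variable (m μ) in
/-- The gradient of the objective, see `Assumptions.gradient_J`. -/
def gradJ (θ : Param N) : Param N := (-2 : ℝ) • m.meanMainDir μ (θ, m.auxTarget μ θ)

namespace Assumptions

theorem _root_.BddLip.exists_bound {X Z F : Type*} [NormedAddCommGroup X] [NormedAddCommGroup F] {f : X → Z → F}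
    (hf : ∀ R, BddLip (Metric.closedBall 0 R) f) (x : X) : ∃ B, ∀ z, ‖f x z‖ ≤ B := by
  obtain ⟨B, -, hB, -⟩ := hf ‖x‖
  exact ⟨B, hB x (by simp)⟩

theorem measurable_tdError_right (hm : m.Assumptions μ rmax C₀ ρ k₁ k₂) (θ : Param N) :
    Measurable (m.tdError θ) :=
  hm.measurable_tdError.comp measurable_prodMk_left

theorem measurable_Vbar_right (hm : m.Assumptions μ rmax C₀ ρ k₁ k₂) (θ : Param N) :
    Measurable fun s : S => m.Vbar s θ :=
  hm.measurable_Vbar.comp (measurable_prodMk_left (x := θ))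

theorem measurable_mainDir_right (hm : m.Assumptions μ rmax C₀ ρ k₁ k₂) (x : Param N × Param N) :
    Measurable (m.mainDir x) := by
  simpa only [Function.comp_def] using
    hm.measurable_mainDir.comp (measurable_prodMk_left (x := x))

theorem measurable_auxDir_right (hm : m.Assumptions μ rmax C₀ ρ k₁ k₂) (x : Param N × Param N) :
    Measurable (m.auxDir x) := by
  simpa only [Function.comp_def] using
    hm.measurable_auxDir.comp (measurable_prodMk_left (x := x))

theorem integrable_tdError_smul (hm : m.Assumptions μ rmax C₀ ρ k₁ k₂) (θ : Param N) :
    Integrable (fun z => m.tdError θ z • m.transFeature z) (m.stationary μ) := by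
  obtain ⟨B, hB⟩ := BddLip.exists_bound
    (fun R => (hm.bddLip_tdError R).smul (hm.bddLip_transFeature _)) θ
  exact hm.integrable_stationary
    ((hm.measurable_tdError_right θ).smul hm.measurable_transFeature) B hB

theorem integrable_mainDir (hm : m.Assumptions μ rmax C₀ ρ k₁ k₂) (x : Param N × Param N) :
    Integrable (m.mainDir x) (m.stationary μ) := by
  obtain ⟨B, hB⟩ := BddLip.exists_bound hm.bddLip_mainDir x
  exact hm.integrable_stationary (hm.measurable_mainDir_right x) B hB

theorem integrable_auxDir (hm : m.Assumptions μ rmax C₀ ρ k₁ k₂) (x : Param N × Param N) :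
    Integrable (m.auxDir x) (m.stationary μ) := by
  obtain ⟨B, hB⟩ := BddLip.exists_bound hm.bddLip_auxDir x
  exact hm.integrable_stationary (hm.measurable_auxDir_right x) B hB

theorem bddLip_meanTd (hm : m.Assumptions μ rmax C₀ ρ k₁ k₂) (R : ℝ) (Z : Type*) :
    BddLip (Metric.closedBall 0 R) fun θ (_ : Z) => m.meanTd μ θ := by
  have := hm.isProbabilityMeasure_stationary
  exact ((hm.bddLip_tdError R).smul (hm.bddLip_transFeature _)).integral (m.stationary μ)
    (fun θ => (hm.integrable_tdError_smul θ).aestronglyMeasurable) Z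

theorem bddLip_auxTarget (hm : m.Assumptions μ rmax C₀ ρ k₁ k₂) (R : ℝ) (Z : Type*) :
    BddLip (Metric.closedBall 0 R) fun θ (_ : Z) => m.auxTarget μ θ :=
  (hm.bddLip_meanTd R Z).clm (m.covInv μ)

theorem bddLip_meanMainDir (hm : m.Assumptions μ rmax C₀ ρ k₁ k₂) (R : ℝ) (Z : Type*) :
    BddLip (Metric.closedBall 0 R) fun x (_ : Z) => m.meanMainDir μ x := by
  have := hm.isProbabilityMeasure_stationary
  exact (hm.bddLip_mainDir R).integral (m.stationary μ)
    (fun x => (hm.integrable_mainDir x).aestronglyMeasurable) Z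

theorem bddLip_gradJ (hm : m.Assumptions μ rmax C₀ ρ k₁ k₂) (R : ℝ) (Z : Type*) :
    BddLip (Metric.closedBall 0 R) fun θ (_ : Z) => m.gradJ μ θ := by
  obtain ⟨L, hL, h1, h2⟩ := hm.bddLip_auxTarget R Unit
  -- The auxiliary target of a parameter in the ball of radius `R` may leave that ball, so the mean
  -- direction is controlled on a larger one.
  have h := (hm.bddLip_meanMainDir (max R L) Z).comp (D' := Metric.closedBall (0 : Param N) R)
    (g := fun θ => (θ, m.auxTarget μ θ)) (L := max 1 L) (fun x hx y hy => by
      rw [Prod.mk_sub_mk, Prod.norm_mk]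
      refine max_le (le_mul_of_one_le_left (norm_nonneg _) (le_max_left _ _)) ?_
      exact (h2 x hx y hy ()).trans (by gcongr; exact le_max_right _ _))
    (fun x hx => by
      have h3 := h1 x hx ()
      rw [mem_closedBall_zero_iff] at hx ⊢
      exact max_le_max hx h3) (id : Z → Z)
  have h2 : BddLip (Metric.closedBall (0 : Param N) R) fun _ (_ : Z) => (-2 : ℝ) :=
    BddLip.const 2 (by simp)
  exact h2.smul h

theorem continuous_auxTarget (hm : m.Assumptions μ rmax C₀ ρ k₁ k₂) :
    Continuous (m.auxTarget μ) :=
  BddLip.continuous (fun R => hm.bddLip_auxTarget R Unit) ()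

theorem continuous_gradJ (hm : m.Assumptions μ rmax C₀ ρ k₁ k₂) : Continuous (m.gradJ μ) :=
  BddLip.continuous (fun R => hm.bddLip_gradJ R Unit) ()

theorem integral_stationary_of_pair (hm : m.Assumptions μ rmax C₀ ρ k₁ k₂) {F : Type*}
    [NormedAddCommGroup F] [NormedSpace ℝ F] [CompleteSpace F] {f : S × A → F}
    (hf : Integrable (fun z : S × A × S => f (z.1, z.2.1)) (m.stationary μ)) :
    ∫ z : S × A × S, f (z.1, z.2.1) ∂(m.stationary μ) = ∫ x, f x ∂μ := by
  have := hm.trans_markov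
  rw [hm.integral_stationary hf]
  simp

theorem integrable_Q_smul_transFeature (hm : m.Assumptions μ rmax C₀ ρ k₁ k₂) (v : Param N) :
    Integrable (fun z : S × A × S => m.Q v z.1 z.2.1 • m.transFeature z) (m.stationary μ) := by
  have h : Measurable fun z : S × A × S => (z.1, z.2.1) := by fun_prop
  refine hm.integrable_stationary (((hm.measurable_Q v).comp h).smul hm.measurable_transFeature)
    ‖v‖ fun z => ?_
  exact (norm_smul _ _).trans_le
    ((mul_le_of_le_one_right (norm_nonneg _) (hm.feature_le _ _)).trans (hm.abs_Q_le _ _ _))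

theorem covOp_eq_stationary (hm : m.Assumptions μ rmax C₀ ρ k₁ k₂) (v : Param N) :
    m.covOp μ v = ∫ z, m.Q v z.1 z.2.1 • m.transFeature z ∂(m.stationary μ) :=
  (hm.integral_stationary_of_pair (f := fun x => m.Q v x.1 x.2 • m.feature x.1 x.2)
    (hm.integrable_Q_smul_transFeature v)).symm

theorem covOp_auxTarget (hm : m.Assumptions μ rmax C₀ ρ k₁ k₂) (θ : Param N) :
    m.covOp μ (m.auxTarget μ θ) = m.meanTd μ θ :=
  hm.covOp_covInv _

/-- The mean of the auxiliary direction is `-C (ω - ω(θ))`. -/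
theorem integral_auxDir (hm : m.Assumptions μ rmax C₀ ρ k₁ k₂) (x : Param N × Param N) :
    ∫ z, m.auxDir x z ∂(m.stationary μ) = - m.covOp μ (x.2 - m.auxTarget μ x.1) := by
  have h : m.covOp μ (x.2 - m.auxTarget μ x.1) + m.covOp μ (m.auxTarget μ x.1)
      = m.covOp μ x.2 := by rw [← hm.covOp_add, sub_add_cancel]
  rw [hm.covOp_auxTarget] at h
  rw [eq_neg_iff_add_eq_zero, ← add_left_inj (m.meanTd μ x.1), add_assoc, h, zero_add,
    hm.covOp_eq_stationary, ← integral_add (hm.integrable_auxDir x)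
      (hm.integrable_Q_smul_transFeature _)]
  refine integral_congr_ae (Filter.Eventually.of_forall fun z => ?_)
  simp only [auxDir, ← add_smul]
  congr 1
  simp [Q, transFeature]

theorem bellman_eq (_hm : m.Assumptions μ rmax C₀ ρ k₁ k₂) (θ : Param N) (s : S) (a : A) :
    m.bellman (m.target θ) (m.Q θ) s a
      = ∫ s', (m.reward s a s' + m.γ * m.Vbar s' θ) ∂(m.trans (s, a)) :=
  rfl

theorem exists_bound_reward_add (hm : m.Assumptions μ rmax C₀ ρ k₁ k₂) (θ : Param N) :
    ∃ B, ∀ s a s', |m.reward s a s' + m.γ * m.Vbar s' θ| ≤ B := by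
  obtain ⟨B, hB⟩ := BddLip.exists_bound (fun R => hm.bddLip_Vbar R) θ
  refine ⟨rmax + |m.γ| * B, fun s a s' => (abs_add_le _ _).trans (add_le_add ?_ ?_)⟩
  · rw [abs_of_nonneg (hm.reward_nonneg _ _ _)]; exact hm.reward_le _ _ _
  · rw [abs_mul]; gcongr; exact hB s'

theorem measurable_reward_add (hm : m.Assumptions μ rmax C₀ ρ k₁ k₂) (θ : Param N) :
    Measurable fun z : S × A × S => m.reward z.1 z.2.1 z.2.2 + m.γ * m.Vbar z.2.2 θ := by
  have h : Measurable fun z : S × A × S => z.2.2 := by fun_prop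
  exact hm.reward_measurable.add (((hm.measurable_Vbar_right θ).comp h).const_mul _)

theorem measurable_bellman (hm : m.Assumptions μ rmax C₀ ρ k₁ k₂) (θ : Param N) :
    Measurable fun x : S × A => m.bellman (m.target θ) (m.Q θ) x.1 x.2 := by
  have := hm.trans_markov
  have h : Measurable fun p : (S × A) × S => (p.1.1, p.1.2, p.2) := by fun_prop
  exact (((hm.measurable_reward_add θ).comp h).stronglyMeasurable.integral_kernel_prod_right'
    (κ := m.trans)).measurable

/-- The Bellman image of Q_θ is Q_θ plus the conditional mean of the temporal difference error.
Testing against φ gives Cθ + E[δφ], so the projected residual is Q at the auxiliary target. -/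
theorem covInv_integral_bellman (hm : m.Assumptions μ rmax C₀ ρ k₁ k₂) (θ : Param N) :
    m.covInv μ (∫ x, m.bellman (m.target θ) (m.Q θ) x.1 x.2 • m.feature x.1 x.2 ∂μ)
      = θ + m.auxTarget μ θ := by
  obtain ⟨B, hB⟩ := hm.exists_bound_reward_add θ
  have hi : Integrable (fun z : S × A × S =>
      (m.reward z.1 z.2.1 z.2.2 + m.γ * m.Vbar z.2.2 θ) • m.transFeature z)
      (m.stationary μ) :=
    hm.integrable_stationary ((hm.measurable_reward_add θ).smul hm.measurable_transFeature) B
      fun z => (norm_smul _ _).trans_le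
        ((mul_le_of_le_one_right (norm_nonneg _) (hm.feature_le _ _)).trans (hB _ _ _))
  have h1 : ∫ x, m.bellman (m.target θ) (m.Q θ) x.1 x.2 • m.feature x.1 x.2 ∂μ
      = ∫ z, (m.reward z.1 z.2.1 z.2.2 + m.γ * m.Vbar z.2.2 θ) • m.transFeature z
          ∂(m.stationary μ) := by
    rw [hm.integral_stationary hi]
    refine integral_congr_ae (Filter.Eventually.of_forall fun x => ?_)
    simp only [hm.bellman_eq, transFeature]
    rw [integral_smul_const]
  have h2 : ∫ z, (m.reward z.1 z.2.1 z.2.2 + m.γ * m.Vbar z.2.2 θ) • m.transFeature z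
          ∂(m.stationary μ) = m.covOp μ θ + m.meanTd μ θ := by
    rw [hm.covOp_eq_stationary, meanTd, ← integral_add (hm.integrable_Q_smul_transFeature _)
      (hm.integrable_tdError_smul θ)]
    refine integral_congr_ae (Filter.Eventually.of_forall fun z => ?_)
    simp only [← add_smul, tdError, δ]
    congr 1
    ring
  rw [h1, h2, map_add, hm.covInv_covOp, auxTarget]

/-- The projected residual is Q_w with w the auxiliary target; its squared norm is ⟨w, Cw⟩, and Cw
is the mean of δφ. -/
theorem J_eq (hm : m.Assumptions μ rmax C₀ ρ k₁ k₂) (θ : Param N) :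
    m.J μ θ = inner ℝ (m.meanTd μ θ) (m.auxTarget μ θ) := by
  have := hm.trans_markov
  obtain ⟨B, hB⟩ := hm.exists_bound_reward_add θ
  have hb : ∀ s a, |m.bellman (m.target θ) (m.Q θ) s a| ≤ B := fun s a => by
    rw [hm.bellman_eq]
    simpa using norm_integral_le_of_norm_le_const (μ := m.trans (s, a))
      (f := fun s' => m.reward s a s' + m.γ * m.Vbar s' θ) (Filter.Eventually.of_forall (hB s a))
  rw [J, hm.proj_eq (hm.measurable_bellman θ) hb, hm.covInv_integral_bellman, ← hm.covOp_auxTarget,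
    real_inner_comm, hm.inner_covOp]
  refine integral_congr_ae (Filter.Eventually.of_forall fun x => ?_)
  simp only [Q, inner_add_right]
  ring

/-- This identity shows that the main direction is the gradient direction. Pointwise, with w the
auxiliary target, the two integrands on the left add up to the integrand on the right plus (δ - ⟨φ,
w⟩)⟨φ, θ' - θ⟩. The extra term is the auxiliary direction tested against θ' - θ, and its mean
vanishes at w. Only the Taylor remainder of the averaged value survives. -/
theorem inner_meanMainDir (hm : m.Assumptions μ rmax C₀ ρ k₁ k₂) (θ θ' : Param N) :
    inner ℝ (m.auxTarget μ θ) (m.meanTd μ θ' - m.meanTd μ θ)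
        + inner ℝ (m.meanMainDir μ (θ, m.auxTarget μ θ)) (θ' - θ)
      = ∫ z, m.γ * inner ℝ (m.auxTarget μ θ) (m.transFeature z) *
          (m.Vbar z.2.2 θ' - m.Vbar z.2.2 θ - inner ℝ (m.phiHat z.2.2 θ) (θ' - θ))
          ∂(m.stationary μ) := by
  set w := m.auxTarget μ θ with hw
  have h0 : inner ℝ (θ' - θ) (∫ z, m.auxDir (θ, w) z ∂(m.stationary μ)) = 0 := by
    rw [hm.integral_auxDir]
    have : m.covOp μ 0 = 0 := by simpa using hm.covOp_smul 0 0
    simp [hw, this]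
  have i1 := hm.integrable_tdError_smul θ'
  have i2 := hm.integrable_tdError_smul θ
  have i3 := hm.integrable_mainDir (θ, w)
  have i4 := hm.integrable_auxDir (θ, w)
  have i5 : Integrable (fun z => inner ℝ w (m.tdError θ' z • m.transFeature z)
      - inner ℝ w (m.tdError θ z • m.transFeature z)) (m.stationary μ) :=
    (i1.const_inner w).sub (i2.const_inner w)
  have i6 : Integrable (fun z => inner ℝ w (m.tdError θ' z • m.transFeature z)
      - inner ℝ w (m.tdError θ z • m.transFeature z) + inner ℝ (θ' - θ) (m.mainDir (θ, w) z))
      (m.stationary μ) := i5.add (i3.const_inner _)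
  rw [← sub_zero (_ + _), ← h0, meanTd, meanTd, meanMainDir, inner_sub_right,
    real_inner_comm (θ' - θ), ← integral_inner i1,
    ← integral_inner i2, ← integral_inner i3, ← integral_inner i4,
    ← integral_sub (i1.const_inner w) (i2.const_inner w),
    ← integral_add i5 (i3.const_inner _), ← integral_sub i6 (i4.const_inner _)]
  refine integral_congr_ae (Filter.Eventually.of_forall fun z => ?_)
  simp only [mainDir, auxDir, inner_sub_right, inner_sub_left, real_inner_smul_right, tdError, δ, Q,
    transFeature, real_inner_comm (m.feature z.1 z.2.1), real_inner_comm (m.phiHat z.2.2 θ)]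
  ring

theorem J_taylor (hm : m.Assumptions μ rmax C₀ ρ k₁ k₂) (R : ℝ) :
    ∃ L : ℝ, 0 ≤ L ∧ ∀ θ θ' : Param N, ‖θ‖ ≤ R → ‖θ'‖ ≤ R →
      |m.J μ θ' - m.J μ θ - inner ℝ (m.gradJ μ θ) (θ' - θ)| ≤ L * ‖θ' - θ‖ ^ 2 := by
  obtain ⟨L₁, hL₁, -, h1⟩ := hm.bddLip_meanTd R Unit
  obtain ⟨L₂, hL₂, h2, -⟩ := hm.bddLip_auxTarget R Unit
  obtain ⟨L₃, hL₃, h3⟩ := hm.Vbar_taylor R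
  refine ⟨2 * (|m.γ| * L₂ * L₃) + ‖m.covInv μ‖ * L₁ ^ 2, by positivity, fun θ θ' hθ hθ' => ?_⟩
  have hθm : θ ∈ Metric.closedBall (0 : Param N) R := by simpa using hθ
  have hθm' : θ' ∈ Metric.closedBall (0 : Param N) R := by simpa using hθ'
  have := hm.isProbabilityMeasure_stationary
  set b := m.meanTd μ θ
  set b' := m.meanTd μ θ'
  -- Exact expansion of the quadratic form b ↦ ⟨b, C⁻¹b⟩ between the two values of the mean. Its
  -- linear part merges with the gradient term into the left side of `inner_meanMainDir`; its
  -- quadratic part is controlled because the mean is Lipschitz in θ.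
  have key : m.J μ θ' - m.J μ θ - inner ℝ (m.gradJ μ θ) (θ' - θ) =
      2 * (inner ℝ (m.auxTarget μ θ) (b' - b)
        + inner ℝ (m.meanMainDir μ (θ, m.auxTarget μ θ)) (θ' - θ))
        + inner ℝ (b' - b) (m.covInv μ (b' - b)) := by
    rw [hm.J_eq, hm.J_eq, gradJ, real_inner_smul_left]
    have e1 : m.auxTarget μ θ = m.covInv μ b := rfl
    have e2 : m.auxTarget μ θ' = m.covInv μ b' := rfl
    change inner ℝ b' _ - inner ℝ b _ - _ = _
    rw [e2, e1, map_sub]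
    simp only [inner_sub_left, inner_sub_right]
    have e3 : inner ℝ b (m.covInv μ b') = inner ℝ b' (m.covInv μ b) := by
      rw [hm.covInv_symm, real_inner_comm]
    rw [e3, real_inner_comm b', real_inner_comm b]
    ring
  rw [key, hm.inner_meanMainDir, add_mul]
  refine (abs_add_le _ _).trans (add_le_add ?_ ?_)
  · rw [abs_mul, abs_two, mul_assoc]
    gcongr
    have hb : ∀ z : S × A × S, ‖m.γ * inner ℝ (m.auxTarget μ θ) (m.transFeature z) *
          (m.Vbar z.2.2 θ' - m.Vbar z.2.2 θ - inner ℝ (m.phiHat z.2.2 θ) (θ' - θ))‖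
          ≤ |m.γ| * L₂ * (L₃ * ‖θ' - θ‖ ^ 2) := fun z => by
      rw [norm_mul, norm_mul]
      gcongr
      · exact le_refl _
      · refine (norm_inner_le_norm _ _).trans ?_
        exact (mul_le_of_le_one_right (norm_nonneg _) (hm.feature_le _ _)).trans (h2 θ hθm ())
      · exact h3 θ θ' hθ hθ' _
    have := norm_integral_le_of_norm_le_const (μ := m.stationary μ)
      (Filter.Eventually.of_forall hb)
    rw [mul_assoc (|m.γ| * L₂)]
    simpa using this
  · have h4 := h1 θ' hθm' θ hθm ()
    calc |inner ℝ (b' - b) (m.covInv μ (b' - b))| ≤ ‖b' - b‖ * (‖m.covInv μ‖ * ‖b' - b‖) :=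
          (abs_real_inner_le_norm _ _).trans (by gcongr; exact (m.covInv μ).le_opNorm _)
      _ = ‖m.covInv μ‖ * ‖b' - b‖ ^ 2 := by ring
      _ ≤ ‖m.covInv μ‖ * (L₁ * ‖θ' - θ‖) ^ 2 := by gcongr
      _ = _ := by ring

theorem hasGradientAt_J (hm : m.Assumptions μ rmax C₀ ρ k₁ k₂) (θ : Param N) :
    HasGradientAt (m.J μ) (m.gradJ μ θ) θ := by
  rw [hasGradientAt_iff_isLittleO]
  obtain ⟨L, hL, h⟩ := hm.J_taylor (‖θ‖ + 1)
  refine Asymptotics.IsBigO.trans_isLittleO ?_ (Asymptotics.isLittleO_pow_sub_sub θ one_lt_two)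
  refine Asymptotics.IsBigO.of_bound L ?_
  filter_upwards [Metric.closedBall_mem_nhds θ one_pos] with θ' hθ'
  have h1 : ‖θ'‖ ≤ ‖θ‖ + 1 := by
    rw [Metric.mem_closedBall, dist_eq_norm] at hθ'
    linarith [norm_le_norm_add_norm_sub' θ' θ]
  simpa using h θ θ' (by linarith) h1

theorem gradient_J (hm : m.Assumptions μ rmax C₀ ρ k₁ k₂) : gradient (m.J μ) = m.gradJ μ :=
  gradient_eq hm.hasGradientAt_J

end Assumptions
end Model
end GreedyGQ
end

/-! ### Mixing of the state chain and the truncated Poisson equation -/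

noncomputable section
namespace GreedyGQ

/-- Layer-cake formula: f + B takes values in [0, 2B], so each integral is the integral over that
interval of the probabilities of superlevel sets, and these differ by at most ε. -/
theorem abs_integral_sub_le_of_tvDist_le {X : Type*} [MeasurableSpace X] {P Q : Measure X}
    [IsProbabilityMeasure P] [IsProbabilityMeasure Q] {ε : ℝ} (h : tvDist P Q ≤ ε) {f : X → ℝ}
    (hf : Measurable f) {B : ℝ} (hB : ∀ x, |f x| ≤ B) :
    |∫ x, f x ∂P - ∫ x, f x ∂Q| ≤ 2 * B * ε := by
  have hset : ∀ U, MeasurableSet U → |P.real U - Q.real U| ≤ ε := by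
    intro U hU
    refine le_trans ?_ h
    -- A real supremum dominates its family only if the family is bounded above; here 1 is a bound.
    refine le_ciSup (f := fun U : {U : Set X // MeasurableSet U} => |P.real U - Q.real U|)
      ⟨1, ?_⟩ ⟨U, hU⟩
    rintro _ ⟨V, rfl⟩
    simp only
    rw [abs_le]
    constructor <;>
      linarith [measureReal_nonneg (μ := P) (s := V.1), measureReal_nonneg (μ := Q) (s := V.1),
        measureReal_le_one (μ := P) (s := V.1), measureReal_le_one (μ := Q) (s := V.1)]
  have hint : ∀ (ν : Measure X) [IsProbabilityMeasure ν], Integrable f ν := fun ν _ =>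
    Integrable.of_bound hf.aestronglyMeasurable B (Filter.Eventually.of_forall hB)
  have hlayer : ∀ (ν : Measure X) [IsProbabilityMeasure ν],
      ∫ x, f x ∂ν + B = ∫ t in Set.Ioc 0 (2 * B), ν.real {a | t ≤ f a + B} := by
    intro ν _
    have h1 := Integrable.integral_eq_integral_Ioc_meas_le (μ := ν) (f := fun x => f x + B)
      (M := 2 * B) ((hint ν).add (integrable_const B))
      (Filter.Eventually.of_forall fun x => by
        have := (abs_le.1 (hB x)).1; simp only [Pi.zero_apply]; linarith)
      (Filter.Eventually.of_forall fun x => by have := (abs_le.1 (hB x)).2; simp only; linarith)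
    rw [← h1, integral_add (hint ν) (integrable_const B)]
    simp
  have hint2 : ∀ (ν : Measure X) [IsProbabilityMeasure ν],
      IntegrableOn (fun t => ν.real {a | t ≤ f a + B}) (Set.Ioc 0 (2 * B)) := by
    intro ν _
    refine Measure.integrableOn_of_bounded (M := 1) measure_Ioc_lt_top.ne ?_ ?_
    · refine (Antitone.measurable fun t t' htt' => ?_).aestronglyMeasurable
      exact measureReal_mono fun a (ha : t' ≤ f a + B) => htt'.trans ha
    · exact Filter.Eventually.of_forall fun t => by
        rw [Real.norm_eq_abs, abs_of_nonneg measureReal_nonneg]; exact measureReal_le_one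
  obtain ⟨x₀⟩ : Nonempty X := P.nonempty_of_neZero
  have hB0 : 0 ≤ B := (abs_nonneg _).trans (hB x₀)
  have e : ∫ x, f x ∂P - ∫ x, f x ∂Q
      = ∫ t in Set.Ioc 0 (2 * B), (P.real {a | t ≤ f a + B} - Q.real {a | t ≤ f a + B}) := by
    rw [integral_sub (hint2 P) (hint2 Q), ← hlayer P, ← hlayer Q]
    ring
  rw [e]
  have h3 := norm_setIntegral_le_of_norm_le_const (μ := volume) (s := Set.Ioc 0 (2 * B))
    (f := fun t => P.real {a | t ≤ f a + B} - Q.real {a | t ≤ f a + B}) (C := ε) measure_Ioc_lt_top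
    fun t _ => hset _ (measurableSet_le measurable_const (hf.add_const B))
  rw [Real.norm_eq_abs, Real.volume_real_Ioc_of_le (by linarith)] at h3
  linarith

namespace Model

variable {S A : Type*} [MeasurableSpace S] [MeasurableSpace A] {N : ℕ}
  {m : Model S A N} {μ : Measure (S × A)} {rmax C₀ ρ k₁ k₂ : ℝ}

variable (m μ) in
/-- The deviation of the `k`-step expectation of `h` from its stationary expectation. -/
def stateDev (k : ℕ) (h : S → ℝ) (s : S) : ℝ :=
  ∫ y, h y ∂((m.stateKernel ^ k) s) - ∫ y, h y ∂(μ.map Prod.fst)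

variable (m μ) in
/-- Truncated solution of the Poisson equation of the state chain. -/
def poisson (n : ℕ) (h : S → ℝ) (s : S) : ℝ := ∑ k ∈ Finset.range n, m.stateDev μ k h s

variable [Fintype A]

namespace Assumptions

theorem isMarkovKernel_pow (hm : m.Assumptions μ rmax C₀ ρ k₁ k₂) (k : ℕ) :
    IsMarkovKernel (m.stateKernel ^ k) := by
  have := hm.isMarkovKernel_stateKernel
  induction k with
  | zero => rw [pow_zero]; exact inferInstanceAs (IsMarkovKernel Kernel.id)
  | succ k ih =>
    rw [pow_succ]
    exact inferInstanceAs (IsMarkovKernel ((m.stateKernel ^ k) ∘ₖ m.stateKernel))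

theorem isProbabilityMeasure_state (hm : m.Assumptions μ rmax C₀ ρ k₁ k₂) :
    IsProbabilityMeasure (μ.map Prod.fst) := by
  have := hm.probability
  exact Measure.isProbabilityMeasure_map measurable_fst.aemeasurable

theorem _root_.MeasureTheory.integrable_of_abs_le {X : Type*} [MeasurableSpace X] {ν : Measure X}
    [IsFiniteMeasure ν] {h : X → ℝ} (hh : Measurable h) {B : ℝ} (hB : ∀ s, |h s| ≤ B) :
    Integrable h ν :=
  Integrable.of_bound hh.aestronglyMeasurable B (Filter.Eventually.of_forall hB)

/-- Ergodicity is assumed for positive times only. At time zero the trivial bound 2B applies, and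
the factor `1 + C₀` covers both cases. -/
theorem abs_stateDev_le (hm : m.Assumptions μ rmax C₀ ρ k₁ k₂) {h : S → ℝ} (hh : Measurable h)
    {B : ℝ} (hB : ∀ s, |h s| ≤ B) (k : ℕ) (s : S) :
    |m.stateDev μ k h s| ≤ 2 * (1 + C₀) * B * ρ ^ k := by
  have := hm.isMarkovKernel_pow k
  have := hm.isProbabilityMeasure_state
  have hB0 : 0 ≤ B := (abs_nonneg _).trans (hB s)
  have hρ := hm.ρ_pos
  have hC := hm.C₀_pos
  rcases Nat.eq_zero_or_pos k with rfl | hk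
  · have h1 : ∀ (ν : Measure S) [IsProbabilityMeasure ν], |∫ y, h y ∂ν| ≤ B := fun ν _ => by
      simpa using norm_integral_le_of_norm_le_const (μ := ν) (f := h)
        (Filter.Eventually.of_forall hB)
    rw [pow_zero, mul_one]
    calc _ ≤ B + B := (abs_sub _ _).trans (add_le_add (h1 _) (h1 _))
      _ ≤ _ := by nlinarith
  · refine (abs_integral_sub_le_of_tvDist_le (hm.ergodic s k hk) hh hB).trans ?_
    have : 0 ≤ B * ρ ^ k := by positivity
    nlinarith

theorem abs_poisson_le (hm : m.Assumptions μ rmax C₀ ρ k₁ k₂) {h : S → ℝ} (hh : Measurable h)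
    {B : ℝ} (hB : ∀ s, |h s| ≤ B) (n : ℕ) (s : S) :
    |m.poisson μ n h s| ≤ 2 * (1 + C₀) / (1 - ρ) * B := by
  have hB0 : 0 ≤ B := (abs_nonneg _).trans (hB s)
  have hρ := hm.ρ_pos
  have hC := hm.C₀_pos
  have hsum : ∑ k ∈ Finset.range n, ρ ^ k ≤ (1 - ρ)⁻¹ :=
    (Summable.sum_le_tsum _ (fun k _ => by positivity)
      (summable_geometric_of_lt_one hρ.le hm.ρ_lt_one)).trans
      (tsum_geometric_of_lt_one hρ.le hm.ρ_lt_one).le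
  calc _ ≤ ∑ k ∈ Finset.range n, 2 * (1 + C₀) * B * ρ ^ k :=
        (Finset.abs_sum_le_sum_abs _ _).trans
          (Finset.sum_le_sum fun k _ => hm.abs_stateDev_le hh hB k s)
    _ = 2 * (1 + C₀) * B * ∑ k ∈ Finset.range n, ρ ^ k := by rw [Finset.mul_sum]
    _ ≤ 2 * (1 + C₀) * B * (1 - ρ)⁻¹ := by gcongr
    _ = _ := by ring

theorem poisson_sub (hm : m.Assumptions μ rmax C₀ ρ k₁ k₂) {h h' : S → ℝ} (hh : Measurable h)
    (hh' : Measurable h') {B : ℝ} (hB : ∀ s, |h s| ≤ B) (hB' : ∀ s, |h' s| ≤ B) (n : ℕ) (s : S) :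
    m.poisson μ n h s - m.poisson μ n h' s = m.poisson μ n (fun y => h y - h' y) s := by
  have := hm.isProbabilityMeasure_state
  rw [poisson, poisson, poisson, ← Finset.sum_sub_distrib]
  refine Finset.sum_congr rfl fun k _ => ?_
  have := hm.isMarkovKernel_pow k
  rw [stateDev, stateDev, stateDev, integral_sub, integral_sub]
  · ring
  all_goals first | exact integrable_of_abs_le hh hB | exact integrable_of_abs_le hh' hB'

theorem measurable_stateDev (hm : m.Assumptions μ rmax C₀ ρ k₁ k₂) {X : Type*}
    [MeasurableSpace X] {f : X → S → ℝ} (hf : Measurable fun p : X × S => f p.1 p.2) (k : ℕ) :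
    Measurable fun p : X × S => m.stateDev μ k (f p.1) p.2 := by
  have := hm.isProbabilityMeasure_state
  have := hm.isMarkovKernel_pow k
  have h1 : Measurable fun q : (X × S) × S => f q.1.1 q.2 :=
    hf.comp (by fun_prop : Measurable fun q : (X × S) × S => (q.1.1, q.2))
  have h2 := (h1.stronglyMeasurable.integral_kernel_prod_right'
    (κ := (m.stateKernel ^ k).comap (Prod.snd : X × S → S) measurable_snd)).measurable
  have h3 := (h1.stronglyMeasurable.integral_prod_right' (ν := μ.map Prod.fst)).measurable
  exact h2.sub h3

theorem measurable_poisson (hm : m.Assumptions μ rmax C₀ ρ k₁ k₂) {X : Type*}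
    [MeasurableSpace X] {f : X → S → ℝ} (hf : Measurable fun p : X × S => f p.1 p.2) (n : ℕ) :
    Measurable fun p : X × S => m.poisson μ n (f p.1) p.2 :=
  Finset.measurable_fun_sum _ fun k _ => hm.measurable_stateDev hf k

theorem measurable_poisson_right (hm : m.Assumptions μ rmax C₀ ρ k₁ k₂) {h : S → ℝ}
    (hh : Measurable h) (n : ℕ) : Measurable (m.poisson μ n h) :=
  (hm.measurable_poisson (X := Unit) (f := fun _ => h) (hh.comp measurable_snd) n).comp
    (measurable_prodMk_left (x := ()))

/-- Applying the state kernel raises the time index of a deviation by one, so the difference on the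
right telescopes to the deviation at time zero minus that at time `n`. Stopping at `n` avoids an
infinite series; the bound on the solution is uniform in `n` and the leftover decays geometrically.
-/
theorem poisson_equation (hm : m.Assumptions μ rmax C₀ ρ k₁ k₂) {h : S → ℝ} (hh : Measurable h)
    {B : ℝ} (hB : ∀ s, |h s| ≤ B) (n : ℕ) (s : S) :
    h s - ∫ y, h y ∂(μ.map Prod.fst) =
      m.poisson μ n h s - ∫ y, m.poisson μ n h y ∂(m.stateKernel s) + m.stateDev μ n h s := by
  have := hm.isProbabilityMeasure_state
  have := hm.isMarkovKernel_stateKernel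
  have hdev : ∀ k, Measurable (m.stateDev μ k h) := fun k =>
    (hm.measurable_stateDev (X := Unit) (f := fun _ => h) (hh.comp measurable_snd) k).comp
      (measurable_prodMk_left (x := ()))
  have hstep : ∀ k, ∫ y, m.stateDev μ k h y ∂(m.stateKernel s) = m.stateDev μ (k + 1) h s := by
    intro k
    have := hm.isMarkovKernel_pow k
    have := hm.isMarkovKernel_pow (k + 1)
    have hi : Integrable h (((m.stateKernel ^ k) ∘ₖ m.stateKernel) s) :=
      integrable_of_abs_le hh hB
    simp only [stateDev]
    rw [integral_sub hi.integral_comp (integrable_const _), ← Kernel.integral_comp hi]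
    rw [pow_succ]
    simp
    rfl
  have h0 : m.stateDev μ 0 h s = h s - ∫ y, h y ∂(μ.map Prod.fst) := by
    have : (m.stateKernel ^ 0) s = Measure.dirac s := by
      rw [pow_zero]; exact Kernel.id_apply s
    rw [stateDev, this, integral_dirac' _ _ hh.stronglyMeasurable]
  have hP : ∫ y, m.poisson μ n h y ∂(m.stateKernel s)
      = ∑ k ∈ Finset.range n, m.stateDev μ (k + 1) h s := by
    simp only [poisson]
    rw [integral_finsetSum]
    · exact Finset.sum_congr rfl fun k _ => hstep k
    · exact fun k _ => integrable_of_abs_le (hdev k) (hm.abs_stateDev_le hh hB k)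
  rw [hP, poisson, ← Finset.sum_sub_distrib, Finset.sum_range_sub' fun k => m.stateDev μ k h s, h0]
  ring

end Assumptions
end Model
end GreedyGQ
end

/-! ### Averaging of Markovian noise along a trajectory -/

noncomputable section
namespace GreedyGQ
namespace Model

variable {S A : Type*} [MeasurableSpace S] [MeasurableSpace A] {N : ℕ}
  {m : Model S A N} {μ : Measure (S × A)} {rmax C₀ ρ k₁ k₂ : ℝ}

/-- The history of a trajectory up to time `t`. -/
def history {Ω : Type*} (s : ℕ → Ω → S) (act : ℕ → Ω → A) (t : ℕ) (w : Ω) :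
    (Fin t → S × A) × S := (fun i => (s i w, act i w), s t w)

/-- The transition of a trajectory at time `t`. -/
def transition {Ω : Type*} (s : ℕ → Ω → S) (act : ℕ → Ω → A) (t : ℕ) (w : Ω) : S × A × S :=
  (s t w, act t w, s (t + 1) w)

/-- `x` is a process adapted to the history of the trajectory. -/
def IsAdapted {Ω X : Type*} [MeasurableSpace X] (s : ℕ → Ω → S) (act : ℕ → Ω → A)
    (x : ℕ → Ω → X) : Prop :=
  ∀ t, ∃ F : (Fin t → S × A) × S → X, Measurable F ∧ ∀ w, x t w = F (history s act t w)

namespace IsTrajectory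

variable {Ω : Type*} [MeasurableSpace Ω] {Pr : Measure Ω} {s : ℕ → Ω → S} {act : ℕ → Ω → A}

theorem measurable_history (h : m.IsTrajectory Pr s act) (t : ℕ) :
    Measurable (history s act t) := by
  have := h.measurable_state
  have := h.measurable_action
  unfold history
  fun_prop

theorem measurable_transition (h : m.IsTrajectory Pr s act) (t : ℕ) :
    Measurable (transition s act t) := by
  have := h.measurable_state
  have := h.measurable_action
  unfold transition
  fun_prop

theorem measurable_of_isAdapted (h : m.IsTrajectory Pr s act) {X : Type*} [MeasurableSpace X]
    {x : ℕ → Ω → X} (hx : IsAdapted s act x) (t : ℕ) : Measurable (x t) := by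
  obtain ⟨F, hF, hxF⟩ := hx t
  have : x t = F ∘ history s act t := funext hxF
  rw [this]
  exact hF.comp (h.measurable_history t)

/-- One step of the Markov property for adapted integrands. -/
theorem integral_transition (h : m.IsTrajectory Pr s act) [IsProbabilityMeasure Pr]
    [IsMarkovKernel m.stepKernel] {X : Type*}
    [MeasurableSpace X] {x : ℕ → Ω → X} (hx : IsAdapted s act x) {g : X → S × A × S → ℝ}
    (hg : Measurable fun p : X × S × A × S => g p.1 p.2) {B : ℝ} (hB : ∀ y z, |g y z| ≤ B)
    (t : ℕ) :
    ∫ w, g (x t w) (transition s act t w) ∂Pr =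
      ∫ w, ∫ p, g (x t w) (s t w, p) ∂(m.stepKernel (s t w)) ∂Pr := by
  obtain ⟨F, hF, hxF⟩ := hx t
  let G : ((Fin t → S × A) × S) × (A × S) → ℝ := fun q => g (F q.1) (q.1.2, q.2)
  have hG : Measurable G := by
    have h1 : Measurable fun q : ((Fin t → S × A) × S) × (A × S) => (F q.1, q.1.2, q.2) := by
      fun_prop
    exact hg.comp h1
  have hfull : Measurable fun w => (history s act t w, (act t w, s (t + 1) w)) :=
    (h.measurable_history t).prodMk
      ((h.measurable_action t).prodMk (h.measurable_state (t + 1)))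
  have : IsProbabilityMeasure (Pr.map (history s act t)) :=
    Measure.isProbabilityMeasure_map (h.measurable_history t).aemeasurable
  have hstep : Pr.map (fun w => (history s act t w, (act t w, s (t + 1) w))) =
      (Pr.map (history s act t)) ⊗ₘ (m.stepKernel.comap Prod.snd measurable_snd) := h.step_law t
  have hGK : Measurable fun y => ∫ p, G (y, p) ∂(m.stepKernel.comap Prod.snd measurable_snd y) :=
    (hG.stronglyMeasurable.integral_kernel_prod_right'
      (κ := m.stepKernel.comap (Prod.snd : (Fin t → S × A) × S → S) measurable_snd)).measurable
  calc ∫ w, g (x t w) (transition s act t w) ∂Pr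
      = ∫ w, G (history s act t w, (act t w, s (t + 1) w)) ∂Pr := by
        simp only [hxF, G]; rfl
    _ = ∫ q, G q ∂((Pr.map (history s act t)) ⊗ₘ (m.stepKernel.comap Prod.snd measurable_snd)) := by
        rw [← hstep, integral_map hfull.aemeasurable hG.aestronglyMeasurable]
    _ = ∫ y, ∫ p, G (y, p) ∂(m.stepKernel.comap Prod.snd measurable_snd y)
          ∂(Pr.map (history s act t)) :=
        Measure.integral_compProd (integrable_of_abs_le hG fun q => hB _ _)
    _ = _ := by
        rw [integral_map (h.measurable_history t).aemeasurable hGK.aestronglyMeasurable]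
        simp only [hxF, G]; rfl

end IsTrajectory

variable [Fintype A]

namespace Assumptions

theorem integral_stateKernel (hm : m.Assumptions μ rmax C₀ ρ k₁ k₂) {h : S → ℝ}
    (hh : Measurable h) (s : S) :
    ∫ y, h y ∂(m.stateKernel s) = ∫ p, h p.2 ∂(m.stepKernel s) := by
  have := hm.isMarkovKernel_stepKernel
  rw [stateKernel, Kernel.snd_apply,
    integral_map measurable_snd.aemeasurable hh.aestronglyMeasurable]

/-- Along the trajectory, the averages of `f (x_t, Z_t)` and of the stationary mean of `f (x_t, ·)`
are close for a slowly varying adapted process `x`. -/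
theorem sum_integral_sub_le (hm : m.Assumptions μ rmax C₀ ρ k₁ k₂) {Ω : Type*}
    [MeasurableSpace Ω] {Pr : Measure Ω} [IsProbabilityMeasure Pr] {s : ℕ → Ω → S}
    {act : ℕ → Ω → A} (h : m.IsTrajectory Pr s act) {X : Type*} [NormedAddCommGroup X]
    [MeasurableSpace X] {x : ℕ → Ω → X} (hx : IsAdapted s act x) {D : Set X}
    (hD : MeasurableSet D) {f : X → S × A × S → ℝ}
    (hf : Measurable fun p : X × S × A × S => f p.1 p.2) {L η : ℝ} (hL : 0 ≤ L)
    (hB : ∀ y ∈ D, ∀ z, |f y z| ≤ L)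
    (hlip : ∀ y ∈ D, ∀ y' ∈ D, ∀ z, |f y z - f y' z| ≤ L * ‖y - y'‖) {T : ℕ}
    (hxD : ∀ᵐ w ∂Pr, ∀ t ≤ T, x t w ∈ D)
    (hη : ∀ᵐ w ∂Pr, ∀ t < T, ‖x (t + 1) w - x t w‖ ≤ η) :
    ∑ t ∈ Finset.range T,
      (∫ w, f (x t w) (transition s act t w) ∂Pr -
        ∫ w, ∫ z, f (x t w) z ∂(m.stationary μ) ∂Pr) ≤
      2 * (1 + C₀) / (1 - ρ) * L * (2 + T * η) := by
  classical
  have := hm.isMarkovKernel_stepKernel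
  have := hm.isMarkovKernel_stateKernel
  have := hm.isProbabilityMeasure_state
  have := hm.isProbabilityMeasure_stationary
  set c := 2 * (1 + C₀) / (1 - ρ) with hc
  have hρ := hm.ρ_pos
  have hρ1 := hm.ρ_lt_one
  have hC := hm.C₀_pos
  have hc0 : 0 ≤ c := div_nonneg (by positivity) (by linarith)
  -- Cutting off outside `D` makes the integrand bounded everywhere; nothing changes almost surely,
  -- since the process stays in `D` up to time `T`.
  let f' : X → S × A × S → ℝ := fun y z => if y ∈ D then f y z else 0
  have hf' : Measurable fun p : X × S × A × S => f' p.1 p.2 :=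
    Measurable.ite (measurable_fst hD) hf measurable_const
  have hB' : ∀ y z, |f' y z| ≤ L := fun y z => by
    by_cases hy : y ∈ D
    · simpa [f', hy] using hB y hy z
    · simpa [f', hy] using hL
  have hf'right : ∀ y, Measurable (f' y) := fun y => hf'.comp measurable_prodMk_left
  -- Averaging over the action and the next state reduces the noise to functions of the state alone,
  -- to which uniform ergodicity applies.
  let q : X → S → ℝ := fun y s => ∫ p, f' y (s, p) ∂(m.stepKernel s)
  have hq : Measurable fun p : X × S => q p.1 p.2 := by
    have h1 : Measurable fun r : (X × S) × (A × S) => f' r.1.1 (r.1.2, r.2) :=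
      hf'.comp (by fun_prop : Measurable fun r : (X × S) × (A × S) => (r.1.1, r.1.2, r.2))
    exact (h1.stronglyMeasurable.integral_kernel_prod_right'
      (κ := m.stepKernel.comap (Prod.snd : X × S → S) measurable_snd)).measurable
  have hqright : ∀ y, Measurable (q y) := fun y => hq.comp measurable_prodMk_left
  have hqB : ∀ y s, |q y s| ≤ L := fun y s => by
    simpa using norm_integral_le_of_norm_le_const (μ := m.stepKernel s)
      (f := fun p => f' y (s, p)) (Filter.Eventually.of_forall fun p => hB' y (s, p))
  have hqlip : ∀ y ∈ D, ∀ y' ∈ D, ∀ s, |q y s - q y' s| ≤ L * ‖y - y'‖ := by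
    intro y hy y' hy' s
    have hi : ∀ y, Integrable (fun p => f' y (s, p)) (m.stepKernel s) := fun y =>
      integrable_of_abs_le ((hf'right y).comp measurable_prodMk_left) fun p => hB' y _
    simp only [q]
    rw [← integral_sub (hi y) (hi y')]
    simpa using norm_integral_le_of_norm_le_const (μ := m.stepKernel s)
      (f := fun p => f' y (s, p) - f' y' (s, p)) (Filter.Eventually.of_forall fun p => by
        simpa [f', hy, hy'] using hlip y hy y' hy' (s, p))
  have hqmean : ∀ y, ∫ z, f' y z ∂(m.stationary μ) = ∫ s, q y s ∂(μ.map Prod.fst) := fun y =>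
    Measure.integral_compProd (integrable_of_abs_le (hf'right y) (hB' y))
  have hxm := h.measurable_of_isAdapted hx
  have hsm := h.measurable_state
  -- The solution is evaluated at (x_t, s_t) and at (x_{t+1}, s_{t+1}) so that the sum over `t`
  -- telescopes. The term `c * (L * η)` pays for replacing x_t by x_{t+1}, the power of `ρ` for
  -- truncation.
  have step : ∀ n : ℕ, ∀ t < T,
      ∫ w, f (x t w) (transition s act t w) ∂Pr -
        ∫ w, ∫ z, f (x t w) z ∂(m.stationary μ) ∂Pr ≤
      (∫ w, m.poisson μ n (q (x t w)) (s t w) ∂Pr -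
        ∫ w, m.poisson μ n (q (x (t + 1) w)) (s (t + 1) w) ∂Pr)
        + (c * (L * η) + 2 * (1 + C₀) * L * ρ ^ n) := by
    intro n t ht
    have hu := hm.measurable_poisson hq n
    have huB : ∀ y s, |m.poisson μ n (q y) s| ≤ c * L := fun y s =>
      hm.abs_poisson_le (hqright y) (hqB y) n s
    have e1 : ∫ w, f (x t w) (transition s act t w) ∂Pr = ∫ w, q (x t w) (s t w) ∂Pr := by
      rw [← h.integral_transition hx hf' hB' t]
      refine integral_congr_ae ?_
      filter_upwards [hxD] with w hw
      simp [f', hw t ht.le]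
    have e2 : ∫ w, ∫ z, f (x t w) z ∂(m.stationary μ) ∂Pr
        = ∫ w, ∫ y, q (x t w) y ∂(μ.map Prod.fst) ∂Pr := by
      refine integral_congr_ae ?_
      filter_upwards [hxD] with w hw
      rw [← hqmean]
      simp [f', hw t ht.le]
    -- Markov property with the parameter frozen at time `t`: the kernel average becomes an
    -- evaluation at the next state.
    have e3 : ∫ w, ∫ y, m.poisson μ n (q (x t w)) y ∂(m.stateKernel (s t w)) ∂Pr
        = ∫ w, m.poisson μ n (q (x t w)) (s (t + 1) w) ∂Pr := by
      have hg : Measurable fun p : X × S × A × S => m.poisson μ n (q p.1) p.2.2.2 :=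
        hu.comp (by fun_prop : Measurable fun p : X × S × A × S => (p.1, p.2.2.2))
      have := h.integral_transition hx (g := fun y z => m.poisson μ n (q y) z.2.2) hg
        (fun y z => huB y z.2.2) t
      simp only [transition] at this
      rw [this]
      refine integral_congr_ae (Filter.Eventually.of_forall fun w => ?_)
      exact hm.integral_stateKernel (hm.measurable_poisson_right (hqright _) n) _
    have i1 : Integrable (fun w => q (x t w) (s t w)) Pr :=
      integrable_of_abs_le (hq.comp ((hxm t).prodMk (hsm t))) fun w => hqB _ _
    have i2 : Integrable (fun w => ∫ y, q (x t w) y ∂(μ.map Prod.fst)) Pr := by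
      have hmeas : Measurable fun y => ∫ s, q y s ∂(μ.map Prod.fst) :=
        (hq.stronglyMeasurable.integral_prod_right' (ν := μ.map Prod.fst)).measurable
      refine integrable_of_abs_le (hmeas.comp (hxm t)) (B := L) fun w => ?_
      simpa using norm_integral_le_of_norm_le_const (μ := μ.map Prod.fst)
        (f := q (x t w)) (Filter.Eventually.of_forall fun p => hqB _ p)
    have hu1 : ∀ t t', Measurable fun w => m.poisson μ n (q (x t w)) (s t' w) := fun t t' =>
      hu.comp ((hxm t).prodMk (hsm t'))
    have i3 : ∀ t t', Integrable (fun w => m.poisson μ n (q (x t w)) (s t' w)) Pr := fun t t' =>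
      integrable_of_abs_le (hu1 t t') fun w => huB _ _
    have i4 : Integrable
        (fun w => ∫ y, m.poisson μ n (q (x t w)) y ∂(m.stateKernel (s t w))) Pr := by
      have h1 : Measurable fun r : (X × S) × S => m.poisson μ n (q r.1.1) r.2 :=
        hu.comp (by fun_prop : Measurable fun r : (X × S) × S => (r.1.1, r.2))
      have hmeas := (h1.stronglyMeasurable.integral_kernel_prod_right'
        (κ := m.stateKernel.comap (Prod.snd : X × S → S) measurable_snd)).measurable
      refine integrable_of_abs_le (hmeas.comp ((hxm t).prodMk (hsm t))) (B := c * L) fun w => ?_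
      simpa using norm_integral_le_of_norm_le_const (μ := m.stateKernel (s t w))
        (f := m.poisson μ n (q (x t w))) (Filter.Eventually.of_forall fun p => huB _ p)
    have hle1 : ∫ w, (q (x t w) (s t w) - ∫ y, q (x t w) y ∂(μ.map Prod.fst)) ∂Pr ≤
        ∫ w, (m.poisson μ n (q (x t w)) (s t w)
          - ∫ y, m.poisson μ n (q (x t w)) y ∂(m.stateKernel (s t w))
          + 2 * (1 + C₀) * L * ρ ^ n) ∂Pr := by
      refine integral_mono (i1.sub i2) (((i3 t t).sub i4).add (integrable_const _)) fun w => ?_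
      simp only
      rw [hm.poisson_equation (hqright _) (hqB _) n]
      have := (abs_le.1 (hm.abs_stateDev_le (hqright (x t w)) (hqB _) n (s t w))).2
      linarith
    have i5 : Integrable (fun w => m.poisson μ n (q (x t w)) (s t w)
          - ∫ y, m.poisson μ n (q (x t w)) y ∂(m.stateKernel (s t w))) Pr := (i3 t t).sub i4
    rw [integral_sub i1 i2, integral_add i5 (integrable_const _),
      integral_sub (i3 t t) i4, e3] at hle1
    have hle2 : ∫ w, m.poisson μ n (q (x (t + 1) w)) (s (t + 1) w) ∂Pr ≤
        ∫ w, (m.poisson μ n (q (x t w)) (s (t + 1) w) + c * (L * η)) ∂Pr := by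
      refine integral_mono_ae (i3 _ _) ((i3 _ _).add (integrable_const _)) ?_
      filter_upwards [hxD, hη] with w hw hw'
      have h1 : ∀ y, |q (x (t + 1) w) y - q (x t w) y| ≤ L * η := fun y =>
        (hqlip _ (hw (t + 1) ht) _ (hw t ht.le) y).trans (by gcongr; exact hw' t ht)
      have h2 := hm.abs_poisson_le ((hqright (x (t + 1) w)).sub (hqright (x t w))) h1 n (s (t + 1) w)
      have h3 := hm.poisson_sub (hqright (x (t + 1) w)) (hqright (x t w)) (hqB _) (hqB _) n
        (s (t + 1) w)
      have h4 := (abs_le.1 (h3 ▸ h2 :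
        |m.poisson μ n (q (x (t + 1) w)) (s (t + 1) w)
          - m.poisson μ n (q (x t w)) (s (t + 1) w)| ≤ c * (L * η))).2
      linarith
    rw [integral_add (i3 t (t + 1)) (integrable_const _)] at hle2
    simp only [integral_const, probReal_univ, one_smul] at hle1 hle2
    rw [e1, e2]
    linarith
  have hfin : ∀ n : ℕ, ∑ t ∈ Finset.range T,
      (∫ w, f (x t w) (transition s act t w) ∂Pr -
        ∫ w, ∫ z, f (x t w) z ∂(m.stationary μ) ∂Pr) ≤
      c * L * (2 + T * η) + T * (2 * (1 + C₀) * L) * ρ ^ n := by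
    intro n
    have huB : ∀ t, |∫ w, m.poisson μ n (q (x t w)) (s t w) ∂Pr| ≤ c * L := fun t => by
      simpa using norm_integral_le_of_norm_le_const (μ := Pr)
        (f := fun w => m.poisson μ n (q (x t w)) (s t w))
        (Filter.Eventually.of_forall fun w => hm.abs_poisson_le (hqright _) (hqB _) n _)
    refine (Finset.sum_le_sum fun t ht => step n t (Finset.mem_range.1 ht)).trans ?_
    rw [Finset.sum_add_distrib,
      Finset.sum_range_sub' fun t => ∫ w, m.poisson μ n (q (x t w)) (s t w) ∂Pr]
    have h1 := (abs_le.1 (huB 0)).2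
    have h2 := (abs_le.1 (huB T)).1
    simp only [Finset.sum_const, Finset.card_range, nsmul_eq_mul]
    linarith
  -- With `T` fixed, the truncation level goes to infinity only after summation.
  have hlim : Filter.Tendsto
      (fun n : ℕ => c * L * (2 + T * η) + T * (2 * (1 + C₀) * L) * ρ ^ n) Filter.atTop
      (nhds (c * L * (2 + T * η) + T * (2 * (1 + C₀) * L) * 0)) :=
    ((tendsto_pow_atTop_nhds_zero_of_lt_one hρ.le hρ1).const_mul _).const_add _
  rw [mul_zero, add_zero] at hlim
  exact ge_of_tendsto' hlim hfin

end Assumptions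
end Model
end GreedyGQ
end

/-! ### One-step drift inequalities for the two Lyapunov functions -/

noncomputable section
namespace GreedyGQ
namespace Model

variable {S A : Type*} [MeasurableSpace S] [MeasurableSpace A] {N : ℕ} [Fintype A]
  {m : Model S A N} {μ : Measure (S × A)} {rmax C₀ ρ k₁ k₂ : ℝ}

variable (m μ) in
/-- The tracking error of the auxiliary iterate. -/
def trackErr (x : Param N × Param N) : Param N := x.2 - m.auxTarget μ x.1

variable (m) in
/-- One step of the algorithm. -/
def update (α β : ℝ) (x : Param N × Param N) (z : S × A × S) : Param N × Param N :=
  (x.1 + α • m.mainDir x z, x.2 + β • m.auxDir x z)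

variable (m μ) in
/-- First order variation of the objective along the main direction. -/
def mainDrift (x : Param N × Param N) (z : S × A × S) : ℝ :=
  inner ℝ (m.gradJ μ x.1) (m.mainDir x z)

variable (m μ) in
/-- First order variation of the tracking error along the auxiliary direction. -/
def auxDrift (x : Param N × Param N) (z : S × A × S) : ℝ :=
  inner ℝ (m.trackErr μ x) (m.auxDir x z)

namespace Assumptions

theorem bddLip_trackErr (hm : m.Assumptions μ rmax C₀ ρ k₁ k₂) (R : ℝ) (Z : Type*) :
    BddLip (Metric.closedBall 0 R) fun x (_ : Z) => m.trackErr μ x :=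
  (bddLip_id R).comp_snd.sub (hm.bddLip_auxTarget R Z).comp_fst

theorem bddLip_mainDrift (hm : m.Assumptions μ rmax C₀ ρ k₁ k₂) (R : ℝ) :
    BddLip (Metric.closedBall 0 R) (m.mainDrift μ) := by
  have h1 := (hm.bddLip_gradJ R (S × A × S)).comp_fst (Y := Param N)
  exact h1.inner (hm.bddLip_mainDir R)

theorem bddLip_auxDrift (hm : m.Assumptions μ rmax C₀ ρ k₁ k₂) (R : ℝ) :
    BddLip (Metric.closedBall 0 R) (m.auxDrift μ) :=
  (hm.bddLip_trackErr R (S × A × S)).inner (hm.bddLip_auxDir R)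

theorem bddLip_J (hm : m.Assumptions μ rmax C₀ ρ k₁ k₂) (R : ℝ) (Z : Type*) :
    BddLip (Metric.closedBall 0 R) fun θ (_ : Z) => m.J μ θ := by
  simp only [hm.J_eq]
  exact (hm.bddLip_meanTd R Z).inner (hm.bddLip_auxTarget R Z)

theorem continuous_trackErr (hm : m.Assumptions μ rmax C₀ ρ k₁ k₂) :
    Continuous (m.trackErr μ) :=
  continuous_snd.sub (hm.continuous_auxTarget.comp continuous_fst)

theorem continuous_J (hm : m.Assumptions μ rmax C₀ ρ k₁ k₂) : Continuous (m.J μ) :=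
  continuous_iff_continuousAt.2 fun θ => (hm.hasGradientAt_J θ).differentiableAt.continuousAt

theorem measurable_mainDrift (hm : m.Assumptions μ rmax C₀ ρ k₁ k₂) :
    Measurable fun p : (Param N × Param N) × S × A × S => m.mainDrift μ p.1 p.2 := by
  have h1 : Measurable fun p : (Param N × Param N) × S × A × S => m.gradJ μ p.1.1 :=
    hm.continuous_gradJ.measurable.comp (by fun_prop)
  exact h1.inner hm.measurable_mainDir

theorem measurable_auxDrift (hm : m.Assumptions μ rmax C₀ ρ k₁ k₂) :
    Measurable fun p : (Param N × Param N) × S × A × S => m.auxDrift μ p.1 p.2 := by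
  have h1 : Measurable fun p : (Param N × Param N) × S × A × S => m.trackErr μ p.1 :=
    hm.continuous_trackErr.measurable.comp measurable_fst
  exact h1.inner hm.measurable_auxDir

/-- The product norm is the maximum and α ≤ β, so the faster auxiliary step governs the
displacement. This supplies the increment bound in the noise estimate. -/
theorem norm_update_sub_le (hm : m.Assumptions μ rmax C₀ ρ k₁ k₂) (R : ℝ) :
    ∃ L : ℝ, 0 ≤ L ∧ ∀ x ∈ Metric.closedBall (0 : Param N × Param N) R, ∀ z α β, 0 ≤ α → α ≤ β →
      ‖m.update α β x z - x‖ ≤ L * β := by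
  obtain ⟨L₁, hL₁, h1, -⟩ := hm.bddLip_mainDir R
  obtain ⟨L₂, hL₂, h2, -⟩ := hm.bddLip_auxDir R
  refine ⟨max L₁ L₂, le_max_of_le_left hL₁, fun x hx z α β hα hαβ => ?_⟩
  have e : m.update α β x z - x = (α • m.mainDir x z, β • m.auxDir x z) := by
    ext1 <;> simp [update]
  have hβ : 0 ≤ β := hα.trans hαβ
  rw [e, Prod.norm_mk, norm_smul, norm_smul, Real.norm_of_nonneg hα, Real.norm_of_nonneg hβ,
    mul_comm _ β]
  refine max_le ?_ ?_
  · exact mul_le_mul hαβ ((h1 x hx z).trans (le_max_left _ _)) (norm_nonneg _) hβ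
  · exact mul_le_mul_of_nonneg_left ((h2 x hx z).trans (le_max_right _ _)) hβ

theorem J_update_le (hm : m.Assumptions μ rmax C₀ ρ k₁ k₂) (R : ℝ) :
    ∃ L : ℝ, 0 ≤ L ∧ ∀ x ∈ Metric.closedBall (0 : Param N × Param N) R, ∀ z α β, 0 ≤ α →
      m.update α β x z ∈ Metric.closedBall (0 : Param N × Param N) R →
      m.J μ (m.update α β x z).1 ≤ m.J μ x.1 + α * m.mainDrift μ x z + L * α ^ 2 := by
  obtain ⟨L₁, hL₁, h1, -⟩ := hm.bddLip_mainDir R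
  obtain ⟨L₂, hL₂, h2⟩ := hm.J_taylor R
  refine ⟨L₂ * L₁ ^ 2, by positivity, fun x hx z α β hα hx' => ?_⟩
  have h3 := h2 x.1 (m.update α β x z).1
    ((norm_fst_le x).trans (mem_closedBall_zero_iff.1 hx))
    ((norm_fst_le (m.update α β x z)).trans (mem_closedBall_zero_iff.1 hx'))
  have e : (m.update α β x z).1 - x.1 = α • m.mainDir x z := by simp [update]
  rw [e, real_inner_smul_right, norm_smul, Real.norm_of_nonneg hα] at h3
  have h4 : L₂ * (α * ‖m.mainDir x z‖) ^ 2 ≤ L₂ * L₁ ^ 2 * α ^ 2 := by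
    calc _ ≤ L₂ * (α * L₁) ^ 2 := by gcongr; exact h1 x hx z
      _ = _ := by ring
  have h5 := (abs_le.1 h3).2
  rw [mainDrift]
  linarith

/-- The auxiliary target is Lipschitz, so it drifts by O(α) in one step. Paired with the bounded
tracking error this costs a full α, which becomes α/β after division by the contraction rate. -/
theorem trackErr_update_le (hm : m.Assumptions μ rmax C₀ ρ k₁ k₂) (R : ℝ) :
    ∃ L : ℝ, 0 ≤ L ∧ ∀ x ∈ Metric.closedBall (0 : Param N × Param N) R, ∀ z α β, 0 ≤ α → α ≤ 1 →
      m.update α β x z ∈ Metric.closedBall (0 : Param N × Param N) R →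
      ‖m.trackErr μ (m.update α β x z)‖ ^ 2 ≤
        ‖m.trackErr μ x‖ ^ 2 + 2 * β * m.auxDrift μ x z + L * (α + β ^ 2) := by
  obtain ⟨L₁, hL₁, h1, -⟩ := hm.bddLip_mainDir R
  obtain ⟨L₂, hL₂, h2, -⟩ := hm.bddLip_auxDir R
  obtain ⟨L₃, hL₃, -, h3⟩ := hm.bddLip_auxTarget R Unit
  obtain ⟨L₄, hL₄, h4, -⟩ := hm.bddLip_trackErr R Unit
  refine ⟨2 * (L₄ * (L₃ * L₁)) + 2 * L₂ ^ 2 + 2 * (L₃ * L₁) ^ 2, by positivity,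
    fun x hx z α β hα hα1 hx' => ?_⟩
  set p := m.trackErr μ x
  set H := m.auxDir x z
  set d := m.auxTarget μ x.1 - m.auxTarget μ (m.update α β x z).1 with hd
  have e : m.trackErr μ (m.update α β x z) = p + (β • H + d) := by
    simp only [trackErr, p, H, hd, update]
    abel
  have hball : ∀ y ∈ Metric.closedBall (0 : Param N × Param N) R,
      y.1 ∈ Metric.closedBall (0 : Param N) R := fun y hy =>
    mem_closedBall_zero_iff.2 ((norm_fst_le y).trans (mem_closedBall_zero_iff.1 hy))
  have hdn : ‖d‖ ≤ L₃ * L₁ * α := by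
    refine (h3 _ (hball x hx) _ (hball _ hx') ()).trans ?_
    rw [mul_assoc]
    gcongr
    have e' : x.1 - (m.update α β x z).1 = -(α • m.mainDir x z) := by simp [update]
    rw [e', norm_neg, norm_smul, Real.norm_of_nonneg hα, mul_comm]
    gcongr
    exact h1 x hx z
  have hp : ‖p‖ ≤ L₄ := h4 x hx ()
  have hH : ‖H‖ ≤ L₂ := h2 x hx z
  have i1 : inner ℝ p d ≤ L₄ * (L₃ * L₁) * α := by
    calc _ ≤ ‖p‖ * ‖d‖ := real_inner_le_norm _ _
      _ ≤ L₄ * (L₃ * L₁ * α) := by gcongr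
      _ = _ := by ring
  have i2 : ‖β • H + d‖ ^ 2 ≤ 2 * (L₂ ^ 2 * β ^ 2) + 2 * ((L₃ * L₁) ^ 2 * α) := by
    have j1 : ‖β • H‖ ^ 2 ≤ L₂ ^ 2 * β ^ 2 := by
      rw [norm_smul, mul_pow, Real.norm_eq_abs, sq_abs, mul_comm]
      gcongr
    have j2 : ‖d‖ ^ 2 ≤ (L₃ * L₁) ^ 2 * α := by
      calc ‖d‖ ^ 2 ≤ (L₃ * L₁ * α) ^ 2 := by gcongr
        _ = (L₃ * L₁) ^ 2 * (α * α) := by ring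
        _ ≤ (L₃ * L₁) ^ 2 * (α * 1) := by gcongr
        _ = _ := by ring
    have j3 : ‖β • H + d‖ ^ 2 ≤ (‖β • H‖ + ‖d‖) ^ 2 := by gcongr; exact norm_add_le _ _
    nlinarith [sq_nonneg (‖β • H‖ - ‖d‖)]
  rw [e, norm_add_sq_real, inner_add_right, real_inner_smul_right]
  have e2 : m.auxDrift μ x z = inner ℝ p H := rfl
  rw [e2]
  have k1 : 0 ≤ L₄ * (L₃ * L₁) * β ^ 2 := by positivity
  have k2 : 0 ≤ L₂ ^ 2 * α := by positivity
  have k3 : 0 ≤ (L₃ * L₁) ^ 2 * β ^ 2 := by positivity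
  nlinarith

/-- With ω at its target the mean direction is -∇J/2. Replacing the target by the actual ω costs at
most a multiple of the tracking error, and Young's inequality gives up half of the decrease, leaving
the factor 1/4. -/
theorem integral_mainDrift_le (hm : m.Assumptions μ rmax C₀ ρ k₁ k₂) (R : ℝ) :
    ∃ L : ℝ, 0 ≤ L ∧ ∀ x ∈ Metric.closedBall (0 : Param N × Param N) R,
      ∫ z, m.mainDrift μ x z ∂(m.stationary μ) ≤
        -(1 / 4) * ‖m.gradJ μ x.1‖ ^ 2 + L * ‖m.trackErr μ x‖ ^ 2 := by
  obtain ⟨L₃, hL₃, h3, -⟩ := hm.bddLip_auxTarget R Unit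
  obtain ⟨L, hL, -, h1⟩ := hm.bddLip_meanMainDir (max R L₃) Unit
  refine ⟨L ^ 2, by positivity, fun x hx => ?_⟩
  have hx0 : ‖x‖ ≤ R := mem_closedBall_zero_iff.1 hx
  have hx1 : ‖x.1‖ ≤ R := (norm_fst_le x).trans hx0
  have e : ∫ z, m.mainDrift μ x z ∂(m.stationary μ)
      = inner ℝ (m.gradJ μ x.1) (m.meanMainDir μ x) :=
    integral_inner (hm.integrable_mainDir x) _
  set g := m.gradJ μ x.1 with hg
  set y : Param N × Param N := (x.1, m.auxTarget μ x.1) with hy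
  have h2 : ‖m.meanMainDir μ x - m.meanMainDir μ y‖ ≤ L * ‖m.trackErr μ x‖ := by
    have := h1 x (mem_closedBall_zero_iff.2 (hx0.trans (le_max_left _ _))) y
      (mem_closedBall_zero_iff.2 (max_le_max hx1 (h3 x.1 (mem_closedBall_zero_iff.2 hx1) ()))) ()
    have e' : x - y = (0, m.trackErr μ x) := by ext1 <;> simp [hy, trackErr]
    rwa [e', Prod.norm_mk, norm_zero, max_eq_right (norm_nonneg _)] at this
  have e2 : m.meanMainDir μ y = (-(1 / 2) : ℝ) • g := by
    rw [hg, gradJ, smul_smul]; norm_num; rfl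
  have e3 : inner ℝ g (m.meanMainDir μ x)
      = -(1 / 2) * ‖g‖ ^ 2 + inner ℝ g (m.meanMainDir μ x - m.meanMainDir μ y) := by
    rw [inner_sub_right, e2, real_inner_smul_right, real_inner_self_eq_norm_sq]
    ring
  have h4 := real_inner_le_norm g (m.meanMainDir μ x - m.meanMainDir μ y)
  have h5 : ‖m.meanMainDir μ x - m.meanMainDir μ y‖ ^ 2 ≤ L ^ 2 * ‖m.trackErr μ x‖ ^ 2 := by
    rw [← mul_pow]; gcongr
  rw [e, e3]
  nlinarith [sq_nonneg (‖g‖ / 2 - ‖m.meanMainDir μ x - m.meanMainDir μ y‖)]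

theorem integral_auxDrift_le (hm : m.Assumptions μ rmax C₀ ρ k₁ k₂) :
    ∃ lam : ℝ, 0 < lam ∧ ∀ x : Param N × Param N,
      ∫ z, m.auxDrift μ x z ∂(m.stationary μ) ≤ -lam * ‖m.trackErr μ x‖ ^ 2 := by
  obtain ⟨lam, hlam, h⟩ := hm.covOp_pos
  refine ⟨lam, hlam, fun x => ?_⟩
  have e : ∫ z, m.auxDrift μ x z ∂(m.stationary μ)
      = inner ℝ (m.trackErr μ x) (∫ z, m.auxDir x z ∂(m.stationary μ)) :=
    integral_inner (hm.integrable_auxDir x) _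
  rw [e, hm.integral_auxDir, inner_neg_right]
  have := h (m.trackErr μ x)
  rw [trackErr] at this ⊢
  linarith

end Assumptions

/-- Telescoping of a stochastic recursive inequality. -/
theorem _root_.MeasureTheory.integral_le_add_sum_of_recursion {Ω : Type*} [MeasurableSpace Ω]
    {Pr : Measure Ω} [IsProbabilityMeasure Pr] {U g : ℕ → Ω → ℝ} {c e : ℝ} {T : ℕ}
    (hU : ∀ t ≤ T, Integrable (U t) Pr) (hg : ∀ t < T, Integrable (g t) Pr)
    (h : ∀ t < T, ∀ᵐ w ∂Pr, U (t + 1) w ≤ U t w + c * g t w + e) :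
    ∫ w, U T w ∂Pr ≤ ∫ w, U 0 w ∂Pr + c * ∑ t ∈ Finset.range T, ∫ w, g t w ∂Pr + T * e := by
  induction T with
  | zero => simp
  | succ T ih =>
    have h1 := ih (fun t ht => hU t (by omega)) (fun t ht => hg t (by omega))
      fun t ht => h t (by omega)
    have i1 := hU T (by omega)
    have i2 := (hg T (by omega)).const_mul c
    have i3 : Integrable (fun w => U T w + c * g T w) Pr := i1.add i2
    have h2 := integral_mono_ae (hU (T + 1) le_rfl) (i3.add (integrable_const e)) (h T (by omega))
    simp only [Pi.add_apply] at h2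
    rw [integral_add i3 (integrable_const e), integral_add i1 i2, integral_const_mul] at h2
    simp only [integral_const, probReal_univ, one_smul] at h2
    rw [Finset.sum_range_succ]
    push_cast
    linarith

end Model
end GreedyGQ
end

/-! ### Summed gradient bound for constant stepsizes -/

noncomputable section
namespace GreedyGQ
namespace Model

variable {S A : Type*} [MeasurableSpace S] [MeasurableSpace A] {N : ℕ} [Fintype A]
  {m : Model S A N} {μ : Measure (S × A)} {rmax C₀ ρ k₁ k₂ : ℝ}

namespace Assumptions

/-- Both one-step inequalities are summed, with the noise estimate exchanging actual drifts for mean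
drifts. The drift of the tracking error contains no gradient term, so its sum is bounded
independently and then fed into the descent of the objective. -/
theorem exists_sum_grad_le (hm : m.Assumptions μ rmax C₀ ρ k₁ k₂) (R : ℝ) :
    ∃ K : ℝ, 0 ≤ K ∧ ∀ (T : ℕ) (α β : ℝ), 0 < α → α ≤ β → β ≤ 1 →
      ∀ (Ω : Type*) [MeasurableSpace Ω] (Pr : Measure Ω) [IsProbabilityMeasure Pr]
        (s : ℕ → Ω → S) (act : ℕ → Ω → A) (x : ℕ → Ω → Param N × Param N),
        m.IsTrajectory Pr s act → IsAdapted s act x →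
        (∀ t w, x (t + 1) w = m.update α β (x t w) (transition s act t w)) →
        (∀ᵐ w ∂Pr, ∀ t ≤ T, x t w ∈ Metric.closedBall (0 : Param N × Param N) R) →
        ∑ t ∈ Finset.range T, ∫ w, ‖m.gradJ μ (x t w).1‖ ^ 2 ∂Pr
          ≤ K * (1 / α + T * (β + α / β)) := by
  obtain ⟨L₁, hL₁, f1b, f1l⟩ := hm.bddLip_mainDrift R
  obtain ⟨L₂, hL₂, f2b, f2l⟩ := hm.bddLip_auxDrift R
  obtain ⟨Lη, hLη, hη⟩ := hm.norm_update_sub_le R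
  obtain ⟨LJ, hLJ, hJ⟩ := hm.J_update_le R
  obtain ⟨LV, hLV, hV⟩ := hm.trackErr_update_le R
  obtain ⟨LM, hLM, hM⟩ := hm.integral_mainDrift_le R
  obtain ⟨lam, hlam, hA⟩ := hm.integral_auxDrift_le
  obtain ⟨BJ, hBJ, bJ, -⟩ := hm.bddLip_J R Unit
  obtain ⟨BV, hBV, bV, -⟩ := hm.bddLip_trackErr R Unit
  obtain ⟨Bg, hBg, bg, -⟩ := hm.bddLip_gradJ R Unit
  have hC := hm.C₀_pos
  have hρ1 := hm.ρ_lt_one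
  set c := 2 * (1 + C₀) / (1 - ρ) with hc
  have hc0 : 0 ≤ c := div_nonneg (by positivity) (by linarith)
  set KV := (BV ^ 2 + c * L₂ * (2 + Lη) + LV) / lam with hKV
  have hKV0 : 0 ≤ KV := by positivity
  refine ⟨4 * (2 * BJ + c * L₁ * (2 + Lη) + LM * KV + LJ), by positivity, ?_⟩
  intro T α β hα hαβ hβ1 Ω _ Pr _ s act x htraj hx hrec hball
  have hβ : 0 < β := hα.trans_le hαβ
  have := hm.isProbabilityMeasure_stationary
  have hxm := htraj.measurable_of_isAdapted hx
  have hzm := htraj.measurable_transition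
  have hfst : ∀ y ∈ Metric.closedBall (0 : Param N × Param N) R,
      y.1 ∈ Metric.closedBall (0 : Param N) R := fun y hy =>
    mem_closedBall_zero_iff.2 ((norm_fst_le y).trans (mem_closedBall_zero_iff.1 hy))
  have hball' : ∀ t ≤ T, ∀ᵐ w ∂Pr, x t w ∈ Metric.closedBall (0 : Param N × Param N) R :=
    fun t ht => hball.mono fun w hw => hw t ht
  -- integrability
  have iJ : ∀ t ≤ T, Integrable (fun w => m.J μ (x t w).1) Pr := fun t ht =>
    Integrable.of_bound ((hm.continuous_J.measurable.comp (hxm t).fst).aestronglyMeasurable) BJ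
      ((hball' t ht).mono fun w hw => bJ _ (hfst _ hw) ())
  have iV : ∀ t ≤ T, Integrable (fun w => ‖m.trackErr μ (x t w)‖ ^ 2) Pr := fun t ht =>
    Integrable.of_bound
      (((hm.continuous_trackErr.norm.pow 2).measurable.comp (hxm t)).aestronglyMeasurable) (BV ^ 2)
      ((hball' t ht).mono fun w hw => by
        rw [norm_pow, norm_norm]; exact pow_le_pow_left₀ (norm_nonneg _) (bV _ hw ()) 2)
  have ig : ∀ t ≤ T, Integrable (fun w => ‖m.gradJ μ (x t w).1‖ ^ 2) Pr := fun t ht =>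
    Integrable.of_bound
      (((hm.continuous_gradJ.norm.pow 2).measurable.comp (hxm t).fst).aestronglyMeasurable) (Bg ^ 2)
      ((hball' t ht).mono fun w hw => by
        rw [norm_pow, norm_norm]; exact pow_le_pow_left₀ (norm_nonneg _) (bg _ (hfst _ hw) ()) 2)
  have if1 : ∀ t ≤ T, Integrable (fun w => m.mainDrift μ (x t w) (transition s act t w)) Pr :=
    fun t ht => Integrable.of_bound
      (hm.measurable_mainDrift.comp ((hxm t).prodMk (hzm t))).aestronglyMeasurable L₁
      ((hball' t ht).mono fun w hw => f1b _ hw _)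
  have if2 : ∀ t ≤ T, Integrable (fun w => m.auxDrift μ (x t w) (transition s act t w)) Pr :=
    fun t ht => Integrable.of_bound
      (hm.measurable_auxDrift.comp ((hxm t).prodMk (hzm t))).aestronglyMeasurable L₂
      ((hball' t ht).mono fun w hw => f2b _ hw _)
  have im1 : ∀ t ≤ T,
      Integrable (fun w => ∫ z, m.mainDrift μ (x t w) z ∂(m.stationary μ)) Pr := fun t ht =>
    Integrable.of_bound
      ((hm.measurable_mainDrift.stronglyMeasurable.integral_prod_right'
        (ν := m.stationary μ)).measurable.comp (hxm t)).aestronglyMeasurable L₁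
      ((hball' t ht).mono fun w hw => by
        simpa using norm_integral_le_of_norm_le_const (μ := m.stationary μ)
          (Filter.Eventually.of_forall (f1b _ hw)))
  have im2 : ∀ t ≤ T,
      Integrable (fun w => ∫ z, m.auxDrift μ (x t w) z ∂(m.stationary μ)) Pr := fun t ht =>
    Integrable.of_bound
      ((hm.measurable_auxDrift.stronglyMeasurable.integral_prod_right'
        (ν := m.stationary μ)).measurable.comp (hxm t)).aestronglyMeasurable L₂
      ((hball' t ht).mono fun w hw => by
        simpa using norm_integral_le_of_norm_le_const (μ := m.stationary μ)
          (Filter.Eventually.of_forall (f2b _ hw)))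
  -- Markovian noise
  have hstep : ∀ᵐ w ∂Pr, ∀ t < T, ‖x (t + 1) w - x t w‖ ≤ Lη * β := hball.mono fun w hw t ht => by
    rw [hrec]; exact hη _ (hw t ht.le) _ α β hα.le hαβ
  have n1 := hm.sum_integral_sub_le htraj hx measurableSet_closedBall hm.measurable_mainDrift hL₁
    f1b f1l hball hstep
  have n2 := hm.sum_integral_sub_le htraj hx measurableSet_closedBall hm.measurable_auxDrift hL₂
    f2b f2l hball hstep
  rw [← hc, Finset.sum_sub_distrib] at n1 n2
  -- mean drifts
  set G := ∑ t ∈ Finset.range T, ∫ w, ‖m.gradJ μ (x t w).1‖ ^ 2 ∂Pr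
  set W := ∑ t ∈ Finset.range T, ∫ w, ‖m.trackErr μ (x t w)‖ ^ 2 ∂Pr
  have d1 : ∑ t ∈ Finset.range T, ∫ w, ∫ z, m.mainDrift μ (x t w) z ∂(m.stationary μ) ∂Pr
      ≤ -(1 / 4) * G + LM * W := by
    rw [Finset.mul_sum, Finset.mul_sum, ← Finset.sum_add_distrib]
    refine Finset.sum_le_sum fun t ht => ?_
    have ht := (Finset.mem_range.1 ht).le
    rw [← integral_const_mul, ← integral_const_mul,
      ← integral_add ((ig t ht).const_mul _) ((iV t ht).const_mul _)]
    exact integral_mono_ae (im1 t ht) (((ig t ht).const_mul _).add ((iV t ht).const_mul _))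
      ((hball' t ht).mono fun w hw => hM _ hw)
  have d2 : ∑ t ∈ Finset.range T, ∫ w, ∫ z, m.auxDrift μ (x t w) z ∂(m.stationary μ) ∂Pr
      ≤ -lam * W := by
    rw [Finset.mul_sum]
    refine Finset.sum_le_sum fun t ht => ?_
    have ht := (Finset.mem_range.1 ht).le
    rw [← integral_const_mul]
    exact integral_mono (im2 t ht) ((iV t ht).const_mul _) fun w => hA _
  -- telescoping
  have t1 := integral_le_add_sum_of_recursion (Pr := Pr) (U := fun t w => m.J μ (x t w).1)
    (g := fun t w => m.mainDrift μ (x t w) (transition s act t w)) (c := α) (e := LJ * α ^ 2)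
    iJ (fun t ht => if1 t ht.le) fun t ht => by
      filter_upwards [hball] with w hw
      have h1 := hw (t + 1) ht
      rw [hrec] at h1
      simp only [hrec]
      exact hJ _ (hw t ht.le) _ α β hα.le h1
  have t2 := integral_le_add_sum_of_recursion (Pr := Pr)
    (U := fun t w => ‖m.trackErr μ (x t w)‖ ^ 2)
    (g := fun t w => m.auxDrift μ (x t w) (transition s act t w)) (c := 2 * β)
    (e := LV * (α + β ^ 2))
    iV (fun t ht => if2 t ht.le) fun t ht => by
      filter_upwards [hball] with w hw
      have h1 := hw (t + 1) ht
      rw [hrec] at h1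
      simp only [hrec]
      exact hV _ (hw t ht.le) _ α β hα.le (hαβ.trans hβ1) h1
  have bJ' : ∀ t ≤ T, |∫ w, m.J μ (x t w).1 ∂Pr| ≤ BJ := fun t ht => by
    simpa using norm_integral_le_of_norm_le_const (μ := Pr) (f := fun w => m.J μ (x t w).1)
      ((hball' t ht).mono fun w hw => bJ _ (hfst _ hw) ())
  have bV0 : ∫ w, ‖m.trackErr μ (x 0 w)‖ ^ 2 ∂Pr ≤ BV ^ 2 := by
    have := integral_mono_ae (iV 0 (Nat.zero_le _)) (integrable_const (BV ^ 2))
      ((hball' 0 (Nat.zero_le _)).mono fun w hw =>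
        pow_le_pow_left₀ (norm_nonneg _) (bV _ hw ()) 2)
    simpa using this
  have bVT : 0 ≤ ∫ w, ‖m.trackErr μ (x T w)‖ ^ 2 ∂Pr := integral_nonneg fun w => by positivity
  have bJ0 := (abs_le.1 (bJ' 0 (Nat.zero_le _))).2
  have bJT := (abs_le.1 (bJ' T le_rfl)).1
  set F₁ := ∑ t ∈ Finset.range T, ∫ w, m.mainDrift μ (x t w) (transition s act t w) ∂Pr
  set F₂ := ∑ t ∈ Finset.range T, ∫ w, m.auxDrift μ (x t w) (transition s act t w) ∂Pr
  -- arithmetic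
  set Y := 1 / α + T * (β + α / β) with hY
  have hT0 : (0 : ℝ) ≤ T := Nat.cast_nonneg T
  have hα1 : α ≤ 1 := hαβ.trans hβ1
  have y0 : 1 / α ≤ Y := by rw [hY]; exact le_add_of_nonneg_right (by positivity)
  have y1 : 1 ≤ Y := le_trans (by rw [le_div_iff₀ hα]; linarith) y0
  have y2 : T * (β + α / β) ≤ Y := by rw [hY]; exact le_add_of_nonneg_left (by positivity)
  have y3 : T * β ≤ Y := le_trans (by gcongr; exact le_add_of_nonneg_right (by positivity)) y2
  have y4 : T * α ≤ Y := le_trans (by gcongr) y3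
  have y5 : 1 / β ≤ Y := le_trans (by gcongr) y0
  have y6 : 2 + T * (Lη * β) ≤ (2 + Lη) * Y := by nlinarith
  have p1 : c * L₁ * (2 + T * (Lη * β)) ≤ c * L₁ * (2 + Lη) * Y := by
    rw [mul_assoc (c * L₁)]; gcongr
  have p2 : c * L₂ * (2 + T * (Lη * β)) ≤ c * L₂ * (2 + Lη) * Y := by
    rw [mul_assoc (c * L₂)]; gcongr
  -- The telescoped tracking inequality is divided by 2β: the initial value turns into a multiple of
  -- 1/β and the stepwise error α + β² into α/β + β.
  have hW : W ≤ KV * Y := by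
    have h1 : 0 ≤ BV ^ 2 + 2 * β * (c * L₂ * (2 + Lη) * Y - lam * W) + T * (LV * (α + β ^ 2)) := by
      have : 2 * β * F₂ ≤ 2 * β * (c * L₂ * (2 + Lη) * Y - lam * W) := by
        gcongr; linarith
      linarith
    have h2 : 2 * β * (lam * W) ≤
        2 * β * (BV ^ 2 * (1 / β) / 2 + c * L₂ * (2 + Lη) * Y + LV * (T * (β + α / β)) / 2) := by
      have : 2 * β * (BV ^ 2 * (1 / β) / 2 + c * L₂ * (2 + Lη) * Y + LV * (T * (β + α / β)) / 2)
          = BV ^ 2 + 2 * β * (c * L₂ * (2 + Lη) * Y) + T * (LV * (α + β ^ 2)) := by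
        field_simp
        ring
      rw [this]
      linarith
    have h3 := le_of_mul_le_mul_left h2 (by positivity)
    have h4 : BV ^ 2 * (1 / β) ≤ BV ^ 2 * Y := by gcongr
    have h5 : LV * (T * (β + α / β)) ≤ LV * Y := by gcongr
    have h6 : 0 ≤ BV ^ 2 * Y := by positivity
    have h7 : 0 ≤ LV * Y := by positivity
    rw [hKV, div_mul_eq_mul_div, le_div_iff₀ hlam]
    linarith
  have h1 : 0 ≤ 2 * BJ + α * (c * L₁ * (2 + Lη) * Y - 1 / 4 * G + LM * W) + T * (LJ * α ^ 2) := by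
    have : α * F₁ ≤ α * (c * L₁ * (2 + Lη) * Y - 1 / 4 * G + LM * W) := by
      gcongr; linarith
    linarith
  have h2 : α * (1 / 4 * G) ≤
      α * (2 * BJ * (1 / α) + c * L₁ * (2 + Lη) * Y + LM * W + LJ * (T * α)) := by
    have : α * (2 * BJ * (1 / α) + c * L₁ * (2 + Lη) * Y + LM * W + LJ * (T * α))
        = 2 * BJ + α * (c * L₁ * (2 + Lη) * Y + LM * W) + T * (LJ * α ^ 2) := by
      field_simp
      ring
    rw [this]
    linarith
  have h3 := le_of_mul_le_mul_left h2 hα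
  have h4 : 2 * BJ * (1 / α) ≤ 2 * BJ * Y := by gcongr
  have h5 : LM * W ≤ LM * (KV * Y) := by gcongr
  have h6 : LJ * (T * α) ≤ LJ * Y := by gcongr
  linarith

end Assumptions
end Model
end GreedyGQ
end

/-! ### Random stopping index and the final rate -/

/-- Expectation of a process evaluated at an independent random index. -/
theorem MeasureTheory.integral_random_index {Ω X : Type*} [MeasurableSpace Ω] [MeasurableSpace X]
    {Pr : Measure Ω} [IsProbabilityMeasure Pr] {Y : Ω → X} (hY : Measurable Y) {M : Ω → ℕ}
    (hM : Measurable M) (hind : IndepFun Y M Pr) {g : ℕ → X → ℝ} (hg : ∀ k, Measurable (g k))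
    {I : Finset ℕ} (hI : ∑ k ∈ I, Pr.real (M ⁻¹' {k}) = 1) {B : ℝ}
    (hB : ∀ᵐ w ∂Pr, ∀ k ∈ I, |g k (Y w)| ≤ B) :
    Integrable (fun w => g (M w) (Y w)) Pr ∧
      ∫ w, g (M w) (Y w) ∂Pr = ∑ k ∈ I, Pr.real (M ⁻¹' {k}) * ∫ w, g k (Y w) ∂Pr := by
  have hset : ∀ k, MeasurableSet (M ⁻¹' {k}) := fun k => hM (measurableSet_singleton k)
  have hMI : ∀ᵐ w ∂Pr, M w ∈ I := by
    have h1 : Pr.real (M ⁻¹' (I : Set ℕ)) = 1 := by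
      have : M ⁻¹' (I : Set ℕ) = ⋃ k ∈ I, M ⁻¹' {k} := by ext; simp
      rw [this, measureReal_biUnion_finset _ fun k _ => hset k, hI]
      intro i _ j _ hij
      exact Disjoint.preimage M (by simpa using hij)
    exact (prob_compl_eq_zero_iff (hM (Finset.measurableSet I))).2 (by
      rwa [measureReal_def, ENNReal.toReal_eq_one_iff] at h1)
  have hmeas : Measurable fun w => g (M w) (Y w) := by
    have : Measurable (Function.uncurry fun (k : ℕ) (x : X) => g k x) :=
      measurable_from_prod_countable_right hg
    exact this.comp (hM.prodMk hY)
  have hint : Integrable (fun w => g (M w) (Y w)) Pr := by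
    refine Integrable.of_bound hmeas.aestronglyMeasurable B ?_
    filter_upwards [hB, hMI] with w hw hw' using hw _ hw'
  refine ⟨hint, ?_⟩
  have hi : ∀ k ∈ I, Integrable (fun w => g k (Y w)) Pr := fun k hk =>
    Integrable.of_bound ((hg k).comp hY).aestronglyMeasurable B (hB.mono fun w hw => hw k hk)
  -- Splitting according to the value of the index gives products of a function of `M` and a
  -- function of `Y`, whose expectations factor by independence.
  have hdecomp : ∫ w, g (M w) (Y w) ∂Pr
      = ∫ w, ∑ k ∈ I, (M ⁻¹' {k}).indicator (fun _ => (1 : ℝ)) w * g k (Y w) ∂Pr := by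
    refine integral_congr_ae ?_
    filter_upwards [hMI] with w hw
    rw [Finset.sum_eq_single_of_mem _ hw]
    · simp
    · intro b _ hb
      rw [Set.indicator_of_notMem (by simpa using hb.symm), zero_mul]
  have hind1 : ∀ k, Measurable ((M ⁻¹' {k}).indicator fun _ => (1 : ℝ)) := fun k =>
    measurable_const.indicator (hset k)
  rw [hdecomp, integral_finsetSum]
  · refine Finset.sum_congr rfl fun k _ => ?_
    have hφ : Measurable (({k} : Set ℕ).indicator fun _ => (1 : ℝ)) :=
      measurable_const.indicator (measurableSet_singleton k)
    have h1 := (hind.symm.comp hφ (hg k)).integral_fun_mul_eq_mul_integral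
      (hφ.comp hM).aestronglyMeasurable ((hg k).comp hY).aestronglyMeasurable
    have h2 : ∫ w, (({k} : Set ℕ).indicator (fun _ => (1 : ℝ)) ∘ M) w ∂Pr
        = Pr.real (M ⁻¹' {k}) := by
      rw [← integral_indicator_one (hset k)]
      rfl
    rw [h2] at h1
    exact h1
  · intro k hk
    refine (hi k hk).bdd_mul (c := 1) (hind1 k).aestronglyMeasurable
      (Filter.Eventually.of_forall fun w => ?_)
    by_cases hw : w ∈ M ⁻¹' {k} <;> simp [Set.indicator, hw]

/-- Conversion of the bound on the averaged gradient norms into the rate in `T`. -/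
theorem GreedyGQ.rate_le {K₀ B a b : ℝ} (hK₀ : 0 ≤ K₀) (hB : 0 ≤ B) (ha : 0 ≤ a) {T : ℕ} (hT : 0 < T) :
    1 / (T : ℝ) * (K₀ * (1 / (1 / (T : ℝ) ^ a) + T * (1 / (T : ℝ) ^ b
        + 1 / (T : ℝ) ^ a / (1 / (T : ℝ) ^ b))) + B) ≤
      (3 * K₀ + B + 2 * K₀ / Real.log 2) *
        (1 / (T : ℝ) ^ (1 - a) + Real.log T / (T : ℝ) ^ (min b (a - b))) := by
  have hT0 : (0 : ℝ) < T := Nat.cast_pos.2 hT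
  have hT1 : (1 : ℝ) ≤ T := Nat.one_le_cast.2 hT
  have hmin : ∀ c : ℝ, min b (a - b) ≤ c → 1 / (T : ℝ) ^ c ≤ 1 / (T : ℝ) ^ (min b (a - b)) :=
    fun c hc => one_div_le_one_div_of_le (by positivity) (Real.rpow_le_rpow_of_exponent_le hT1 hc)
  have e1 : 1 / (T : ℝ) * (1 / (1 / (T : ℝ) ^ a)) = 1 / (T : ℝ) ^ (1 - a) := by
    rw [Real.rpow_sub hT0, Real.rpow_one]; field_simp
  have e2 : 1 / (T : ℝ) ^ a / (1 / (T : ℝ) ^ b) = 1 / (T : ℝ) ^ (a - b) := by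
    rw [Real.rpow_sub hT0]; field_simp
  have e3 : 1 / (T : ℝ) ≤ 1 / (T : ℝ) ^ (1 - a) := by
    refine one_div_le_one_div_of_le (by positivity) ?_
    calc (T : ℝ) ^ (1 - a) ≤ (T : ℝ) ^ (1 : ℝ) :=
          Real.rpow_le_rpow_of_exponent_le hT1 (by linarith)
      _ = T := Real.rpow_one _
  set X := 1 / (T : ℝ) ^ (1 - a)
  set Y := 1 / (T : ℝ) ^ (min b (a - b)) with hY
  have hX : 0 ≤ X := by positivity
  have hY0 : 0 ≤ Y := by positivity
  have h1 : 1 / (T : ℝ) * (K₀ * (1 / (1 / (T : ℝ) ^ a) + T * (1 / (T : ℝ) ^ b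
        + 1 / (T : ℝ) ^ a / (1 / (T : ℝ) ^ b))) + B) ≤ (K₀ + B) * X + 2 * K₀ * Y := by
    have : 1 / (T : ℝ) * (K₀ * (1 / (1 / (T : ℝ) ^ a) + T * (1 / (T : ℝ) ^ b
        + 1 / (T : ℝ) ^ a / (1 / (T : ℝ) ^ b))) + B) =
        K₀ * (1 / (T : ℝ) * (1 / (1 / (T : ℝ) ^ a))) + K₀ * (1 / (T : ℝ) ^ b)
        + K₀ * (1 / (T : ℝ) ^ a / (1 / (T : ℝ) ^ b)) + B * (1 / (T : ℝ)) := by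
      field_simp
      ring
    rw [this, e1, e2]
    have i1 := mul_le_mul_of_nonneg_left (hmin b (min_le_left _ _)) hK₀
    have i2 := mul_le_mul_of_nonneg_left (hmin (a - b) (min_le_right _ _)) hK₀
    have i3 := mul_le_mul_of_nonneg_left e3 hB
    linarith
  refine h1.trans ?_
  have hlog2 : 0 < Real.log 2 := Real.log_pos one_lt_two
  have e4 : Real.log T / (T : ℝ) ^ (min b (a - b)) = Real.log T * Y := by rw [hY]; ring
  rw [e4]
  have hq : 0 ≤ 2 * K₀ / Real.log 2 := by positivity
  -- At `T = 1` the logarithm vanishes while X = Y = 1, so the first term must absorb `2 * K₀`;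
  -- hence `3 * K₀` in the constant. For larger `T`, log T ≥ log 2 accounts for the quotient by
  -- `Real.log 2`.
  rcases Nat.lt_or_ge T 2 with h | h
  · obtain rfl : T = 1 := by omega
    simp only [Nat.cast_one, Real.one_rpow, div_one, Real.log_one, zero_mul, add_zero, X, Y]
    linarith
  · have hlog : Real.log 2 ≤ Real.log T := Real.log_le_log two_pos (by exact_mod_cast h)
    have hK : 2 * K₀ * Y ≤ 2 * K₀ / Real.log 2 * (Real.log T * Y) := by
      rw [div_mul_eq_mul_div, le_div_iff₀ hlog2]
      calc _ = 2 * K₀ * (Real.log 2 * Y) := by ring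
        _ ≤ _ := by gcongr
    have hl : 0 ≤ Real.log T * Y := mul_nonneg (hlog2.le.trans hlog) hY0
    have j1 : 0 ≤ (3 * K₀ + B) * (Real.log T * Y) := mul_nonneg (by positivity) hl
    have j2 : 0 ≤ (2 * K₀ + 2 * K₀ / Real.log 2) * X := by positivity
    linarith

theorem theorem1 {S A : Type*} [MeasurableSpace S] [MeasurableSpace A]
    [Fintype A] [MeasurableSingletonClass A] {N : ℕ}
    (m : GreedyGQ.Model S A N) (μ : Measure (S × A)) (rmax C₀ ρ k₁ k₂ : ℝ)
    (hm : m.Assumptions μ rmax C₀ ρ k₁ k₂)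
    (a b : ℝ) (ha : 1 / 2 < a) (ha' : a ≤ 1) (hb : 0 < b) (hb' : b ≤ a)
    (R : ℝ) :
    Differentiable ℝ (m.J μ) ∧
    ∃ K : ℝ, ∀ T : ℕ, 0 < T →
      ∀ (α β : ℕ → ℝ), (∀ t, α t = 1 / (T : ℝ) ^ a) → (∀ t, β t = 1 / (T : ℝ) ^ b) →
      ∀ (θ₀ ω₀ : EuclideanSpace ℝ (Fin N))
        (Ω : Type*) [MeasurableSpace Ω] (Pr : Measure Ω) [IsProbabilityMeasure Pr]
        (s : ℕ → Ω → S) (act : ℕ → Ω → A) (θ ω : ℕ → Ω → EuclideanSpace ℝ (Fin N)),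
        m.IsTrajectory Pr s act →
        (∀ t w, (θ t w, ω t w) = m.iter α β θ₀ ω₀ (fun i => s i w) (fun i => act i w) t) →
        (∀ᵐ w ∂Pr, ∀ t ≤ T, ‖θ t w‖ ≤ R ∧ ‖ω t w‖ ≤ R) →
        ∀ (k₀ : ℕ), k₀ ≤ 1 →
        ∀ (M : Ω → ℕ), Measurable M →
          IndepFun (fun w (t : ℕ) => (s t w, act t w)) M Pr →
          (∀ k ∈ Finset.Icc k₀ T,
            Pr.real (M ⁻¹' {k}) = α k / ∑ t ∈ Finset.Icc k₀ T, α t) →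
          Integrable (fun w => ‖gradient (m.J μ) (θ (M w) w)‖ ^ 2) Pr ∧
          ∫ w, ‖gradient (m.J μ) (θ (M w) w)‖ ^ 2 ∂Pr ≤
            K * (1 / (T : ℝ) ^ (1 - a) + Real.log T / (T : ℝ) ^ (min b (a - b))) := by
  refine ⟨fun θ => (hm.hasGradientAt_J θ).differentiableAt, ?_⟩
  obtain ⟨K₀, hK₀, hsum⟩ := hm.exists_sum_grad_le R
  obtain ⟨Bg, hBg, bg, -⟩ := hm.bddLip_gradJ R Unit
  refine ⟨3 * K₀ + Bg ^ 2 + 2 * K₀ / Real.log 2, ?_⟩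
  intro T hT α β hα hβ θ₀ ω₀ Ω _ Pr _ s act θ ω htraj hiter hbd k₀ hk₀ M hM hind hlaw
  rw [hm.gradient_J]
  have hT1 : (1 : ℝ) ≤ T := Nat.one_le_cast.2 hT
  have hT0 : (0 : ℝ) < T := by linarith
  have hα0 : 0 < 1 / (T : ℝ) ^ a := by positivity
  let Y : Ω → ℕ → S × A := fun w t => (s t w, act t w)
  have hY : Measurable Y := measurable_pi_lambda _ fun t =>
    (htraj.measurable_state t).prodMk (htraj.measurable_action t)
  let g : ℕ → (ℕ → S × A) → ℝ := fun k p =>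
    ‖m.gradJ μ (m.iter α β θ₀ ω₀ (fun i => (p i).1) (fun i => (p i).2) k).1‖ ^ 2
  have hg : ∀ k, Measurable (g k) := fun k =>
    (hm.continuous_gradJ.norm.pow 2).measurable.comp (hm.measurable_iter α β θ₀ ω₀ k).fst
  have hgY : ∀ k w, g k (Y w) = ‖m.gradJ μ (θ k w)‖ ^ 2 := fun k w => by
    have : (m.iter α β θ₀ ω₀ (fun i => s i w) (fun i => act i w) k).1 = θ k w := by
      rw [← hiter]
    simp only [g, Y, this]
  have hgB : ∀ᵐ w ∂Pr, ∀ k ≤ T, g k (Y w) ≤ Bg ^ 2 := by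
    filter_upwards [hbd] with w hw k hk
    rw [hgY]
    exact pow_le_pow_left₀ (norm_nonneg _)
      (bg _ (mem_closedBall_zero_iff.2 (hw k hk).1) ()) 2
  have hg0 : ∀ k w, 0 ≤ g k (Y w) := fun k w => by positivity
  -- The stepsizes are constant, so `M` is uniform on `T` or `T + 1` points according to `k₀`; in
  -- both cases each weight is at most 1/T.
  have hcard : ((Finset.Icc k₀ T).card : ℝ) ≥ T := by
    rw [Nat.card_Icc]; exact_mod_cast (by omega)
  have hlaw' : ∀ k ∈ Finset.Icc k₀ T, Pr.real (M ⁻¹' {k}) = 1 / (Finset.Icc k₀ T).card := by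
    intro k hk
    rw [hlaw k hk]
    simp only [hα, Finset.sum_const, nsmul_eq_mul]
    have : ((Finset.Icc k₀ T).card : ℝ) ≠ 0 := by linarith
    field_simp
  have hone : ∑ k ∈ Finset.Icc k₀ T, Pr.real (M ⁻¹' {k}) = 1 := by
    rw [Finset.sum_congr rfl hlaw', Finset.sum_const, nsmul_eq_mul]
    exact mul_one_div_cancel (by linarith)
  obtain ⟨hint, hval⟩ := integral_random_index hY hM hind hg hone (B := Bg ^ 2)
    (hgB.mono fun w hw k hk => by
      rw [abs_of_nonneg (hg0 k w)]; exact hw k (Finset.mem_Icc.1 hk).2)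
  simp only [hgY] at hint hval
  refine ⟨hint, ?_⟩
  have hadapt : GreedyGQ.Model.IsAdapted s act fun t w => (θ t w, ω t w) := fun t => by
    obtain ⟨F, hF, h⟩ := hm.exists_iter_eq_history α β θ₀ ω₀ t
    exact ⟨F, hF, fun w => (hiter t w).trans (h _ _)⟩
  have hE := hsum T (1 / (T : ℝ) ^ a) (1 / (T : ℝ) ^ b) hα0
    (one_div_le_one_div_of_le (by positivity) (Real.rpow_le_rpow_of_exponent_le hT1 hb'))
    (by rw [div_le_one (by positivity)]; exact Real.one_le_rpow hT1 hb.le)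
    Ω Pr s act (fun t w => (θ t w, ω t w)) htraj hadapt
    (fun t w => by
      rw [hiter, hiter, GreedyGQ.Model.iter_succ, hα, hβ]
      rfl)
    (hbd.mono fun w hw t ht => mem_closedBall_zero_iff.2 (max_le (hw t ht).1 (hw t ht).2))
  -- The summed estimate covers times before `T` only, while `M` may equal `T`; that single term is
  -- bounded by the size of the gradient on the ball.
  have hlast : ∫ w, ‖m.gradJ μ (θ T w)‖ ^ 2 ∂Pr ≤ Bg ^ 2 := by
    have := norm_integral_le_of_norm_le_const (μ := Pr) (f := fun w => g T (Y w)) (C := Bg ^ 2)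
      (hgB.mono fun w hw => by
        rw [Real.norm_of_nonneg (hg0 T w)]; exact hw T le_rfl)
    simp only [hgY, probReal_univ, mul_one] at this
    exact (le_abs_self _).trans this
  have hEk : ∀ k, 0 ≤ ∫ w, ‖m.gradJ μ (θ k w)‖ ^ 2 ∂Pr := fun k =>
    integral_nonneg fun w => by positivity
  calc ∫ w, ‖m.gradJ μ (θ (M w) w)‖ ^ 2 ∂Pr
      ≤ ∑ k ∈ Finset.Icc k₀ T, 1 / (T : ℝ) * ∫ w, ‖m.gradJ μ (θ k w)‖ ^ 2 ∂Pr := by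
        rw [hval]
        refine Finset.sum_le_sum fun k hk => ?_
        rw [hlaw' k hk]
        exact mul_le_mul_of_nonneg_right (one_div_le_one_div_of_le hT0 hcard) (hEk k)
    _ ≤ ∑ k ∈ Finset.range (T + 1), 1 / (T : ℝ) * ∫ w, ‖m.gradJ μ (θ k w)‖ ^ 2 ∂Pr :=
        Finset.sum_le_sum_of_subset_of_nonneg (fun k hk => by
          rw [Finset.mem_Icc] at hk; exact Finset.mem_range.2 (by omega))
          fun k _ _ => mul_nonneg (by positivity) (hEk k)
    _ = 1 / (T : ℝ) * (∑ k ∈ Finset.range T, ∫ w, ‖m.gradJ μ (θ k w)‖ ^ 2 ∂Pr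
          + ∫ w, ‖m.gradJ μ (θ T w)‖ ^ 2 ∂Pr) := by
        rw [← Finset.mul_sum, Finset.sum_range_succ]
    _ ≤ 1 / (T : ℝ) * (K₀ * (1 / (1 / (T : ℝ) ^ a) + T * (1 / (T : ℝ) ^ b
          + 1 / (T : ℝ) ^ a / (1 / (T : ℝ) ^ b))) + Bg ^ 2) :=
        mul_le_mul_of_nonneg_left (add_le_add hE hlast) (by positivity)
    _ ≤ _ := GreedyGQ.rate_le hK₀ (by positivity) (by linarith) hT
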